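/- **Setting.** Let $(Z_t)_{t\in\mathbb Z}$ be i.i.d. positive random variables with $\mathbb E Z_t=1$ and density $f_Z$. Let $a_0>0$ and $a_j\ge 0$ $(j\ge1)$ satisfy $\sum_{j\ge1}a_j<1-\delta$ for some $\delta>0$. Let $(X_t)_{t\in\mathbb Z}$ be a strictly stationary non-negative squared ARCH$(\infty)$ process, i.e. $X_t=Z_t\bigl(a_0+\sum_{j\ge1}a_jX_{t-j}\bigr)$ almost surely for all $t$, where $Z_t$ is independent of $(X_s)_{s<t}$; and suppose $\mathbb E|X_0|^\nu<\infty$ for some $\nu>1$. Define $\psi_j$ by $\bigl(1-\sum_{j\ge1}a_jz^j\bigr)^{-1}=\sum_{j\ge0}\psi_jz^j$. For $k\ge 1$ put $$\alpha(k)=\sup_{t}\ \sup_{G,H}|P(G\cap H)-P(G)P(H)|,\qquad \beta(k)=\sup_{t}\ \sup_{\{G_i\},\{H_j\}}\sum_{i,j}|P(G_i\cap H_j)-P(G_i)P(H_j)|,$$ where $G\in\sigma(X_{t+k},X_{t+k+1},\dots)$, $H\in\sigma(X_t,X_{t-1},\dots)$, and $\{G_i\}$, $\{H_j\}$ run over the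 finite partitions of the sample space into sets of these two $\sigma$-algebras. Consider, for a finite constant $L\ge0$, the conditions (iii) $\int|f_Z(u)-f_Z(u[1+c])|\,du\le Lc$ for all $c>0$; (iv) $\int\sup_{0\le\tau\le c}|f_Z(u)-f_Z(u[1+\tau])|\,du\le Lc$ for all $c>0$. **Theorem 4.1.** (a) If (iii) holds, then for all $k\ge1$ $$\alpha(k)\le K(\nu)(1+L)^{\frac{\nu}{\nu+1}}\sum_{i=0}^\infty\Bigl[\frac1{a_0}\sum_{s=0}^\infty\sum_{j=s+1}^{k+s}a_j\sum_{l=0}^{k+s-j}|\psi_l|\,a_{k+s-j-l+i}+\frac1{a_0}\sum_{s=0}^\infty a_{k+s+i}\Bigr]^{\frac{\nu}{\nu+1}}\bigl[\mathbb E|X_0|^\nu\bigr]^{\frac1{\nu+1}},$$ where $K(\nu)=3\bigl(\nu^{1/(1+\nu)}+\nu^{-\nu/(\nu+1)}\bigr)$ and the right-hand side may be $+\infty$. Moreover: (i) if $a_j=O(j^{-\gamma})$ and $\psi_j=O(j^{-\gamma})$ as $j\to\infty$ for some real $\gamma$, then with $\tilde\gamma=\gamma\nu/(\nu+1)$ there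 is a finite $K$ such that $\alpha(k)\le K\bigl[k(k+1)^{-\tilde\gamma+3}+(k+1)^{-\tilde\gamma+2}\bigr]$ for all $k\ge1$; (ii) if $a_j=O(\rho^{j})$ and $\psi_j=O(\rho^{j})$ as $j\to\infty$ for some $0<\rho<1$, then there is a finite $C$ such that $\alpha(k)\le C\,k\,\rho^{k/2}$ for all $k\ge1$. (b) If (iv) holds, then the series bound of (a) and the rates (i) and (ii) hold with $\beta(k)$ in place of $\alpha(k)$. -/

import Mathlib

open MeasureTheory ProbabilityTheory Filter Asymptotics
open scoped ENNReal NNReal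

noncomputable section

/-- The past `σ(X_t, X_{t-1}, …)`. -/
def pastSigma {Ω : Type*} (X : ℤ → Ω → ℝ) (t : ℤ) : MeasurableSpace Ω :=
  ⨆ s : ℤ, ⨆ _ : s ≤ t, MeasurableSpace.comap (X s) inferInstance

/-- The future `σ(X_t, X_{t+1}, …)`. -/
def futureSigma {Ω : Type*} (X : ℤ → Ω → ℝ) (t : ℤ) : MeasurableSpace Ω :=
  ⨆ s : ℤ, ⨆ _ : t ≤ s, MeasurableSpace.comap (X s) inferInstance

/-- The strong mixing coefficient
`α(k) = sup_t sup_{H ∈ σ(X_t, X_{t-1}, …), G ∈ σ(X_{t+k}, X_{t+k+1}, …)} |P(G ∩ H) - P(G) P(H)|`. -/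
def alphaMixing {Ω : Type*} [MeasurableSpace Ω] (P : Measure Ω) (X : ℤ → Ω → ℝ) (k : ℕ) : ℝ≥0∞ :=
  ⨆ (t : ℤ) (H : Set Ω) (_ : MeasurableSet[pastSigma X t] H)
    (G : Set Ω) (_ : MeasurableSet[futureSigma X (t + k)] G),
    ENNReal.ofReal |P.real (G ∩ H) - P.real G * P.real H|

/-- `A` is a finite partition of `Ω` into sets of the σ-algebra `m`. -/
structure IsFinPartition {Ω : Type*} (m : MeasurableSpace Ω) {n : ℕ} (A : Fin n → Set Ω) :
    Prop where
  measurable : ∀ i, MeasurableSet[m] (A i)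
  disjoint : Pairwise fun i j => Disjoint (A i) (A j)
  cover : ⋃ i, A i = Set.univ

/-- The absolute regularity coefficient
`β(k) = sup_t sup_{{H_j}, {G_i}} ∑_i ∑_j |P(G_i ∩ H_j) - P(G_i) P(H_j)|`, over the finite
partitions `{H_j}` in `σ(X_t, X_{t-1}, …)` and `{G_i}` in `σ(X_{t+k}, X_{t+k+1}, …)`
(no factor `1/2`). -/
def betaMixing {Ω : Type*} [MeasurableSpace Ω] (P : Measure Ω) (X : ℤ → Ω → ℝ) (k : ℕ) : ℝ≥0∞ :=
  ⨆ (t : ℤ) (m : ℕ) (H : Fin m → Set Ω) (_ : IsFinPartition (pastSigma X t) H)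
    (n : ℕ) (G : Fin n → Set Ω) (_ : IsFinPartition (futureSigma X (t + k)) G),
    ENNReal.ofReal (∑ i, ∑ j, |P.real (G i ∩ H j) - P.real (G i) * P.real (H j)|)

/-- Strict stationarity: every shift of the process has the same law on path space. -/
def IsStrictlyStationary {Ω : Type*} [MeasurableSpace Ω] (P : Measure Ω) (X : ℤ → Ω → ℝ) : Prop :=
  ∀ h : ℤ, P.map (fun ω t => X (t + h) ω) = P.map (fun ω t => X t ω)

/-- `X` is a squared ARCH(∞) process with parameters `a` (`a 0` is the intercept) and
innovations `Z`: `Z` is i.i.d., positive and has mean one, `Z t` is independent of the past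
`X (t-1), X (t-2), …`, and `X t = Z t * (a 0 + ∑_{j ≥ 1} a j * X (t - j))`. -/
structure IsSqARCHInfty {Ω : Type*} [MeasurableSpace Ω] (P : Measure Ω)
    (X Z : ℤ → Ω → ℝ) (a : ℕ → ℝ) : Prop where
  param_pos : 0 < a 0
  param_nonneg : ∀ j, 0 ≤ a j
  measurable_X : ∀ t, Measurable (X t)
  measurable_Z : ∀ t, Measurable (Z t)
  Z_indep : iIndepFun Z P
  Z_identDistrib : ∀ t, IdentDistrib (Z t) (Z 0) P P
  Z_pos : ∀ t, ∀ᵐ ω ∂P, 0 < Z t ω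
  Z_mean : ∫ ω, Z 0 ω ∂P = 1
  Z_indep_past : ∀ t, Indep (MeasurableSpace.comap (Z t) inferInstance) (pastSigma X (t - 1)) P
  X_nonneg : ∀ t, ∀ᵐ ω ∂P, 0 ≤ X t ω
  X_summable : ∀ t, ∀ᵐ ω ∂P, Summable fun j : ℕ => a (j + 1) * X (t - (j + 1)) ω
  X_eq : ∀ t, ∀ᵐ ω ∂P, X t ω = Z t ω * (a 0 + ∑' j : ℕ, a (j + 1) * X (t - (j + 1)) ω)

/-- `f` is a probability density of the real random variable `Y`. -/
structure IsDensityOf {Ω : Type*} [MeasurableSpace Ω] (P : Measure Ω) (Y : Ω → ℝ) (f : ℝ → ℝ) :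
    Prop where
  measurable : Measurable f
  nonneg : ∀ u, 0 ≤ f u
  map_eq : P.map Y = volume.withDensity fun u => ENNReal.ofReal (f u)

/-- `∫ |f(u) - f(u(1 + c))| du ≤ L c` for all `c > 0`. -/
def DilationLipschitz (f : ℝ → ℝ) (L : ℝ≥0) : Prop :=
  ∀ c : ℝ, 0 < c → ∫⁻ u, ENNReal.ofReal |f u - f (u * (1 + c))| ≤ L * ENNReal.ofReal c

/-- `∫ sup_{0 ≤ τ ≤ c} |f(u) - f(u(1 + τ))| du ≤ L c` for all `c > 0`. -/
def SupDilationLipschitz (f : ℝ → ℝ) (L : ℝ≥0) : Prop :=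
  ∀ c : ℝ, 0 < c →
    ∫⁻ u, ⨆ τ ∈ Set.Icc (0 : ℝ) c, ENNReal.ofReal |f u - f (u * (1 + τ))| ≤ L * ENNReal.ofReal c

/-- The coefficients `ψ_j` of `(1 - ∑_{j ≥ 1} a_j z^j)⁻¹ = ∑_{j ≥ 0} ψ_j z^j`. -/
def archPsi (a : ℕ → ℝ) (j : ℕ) : ℝ :=
  PowerSeries.coeff j (1 - PowerSeries.mk fun i => if i = 0 then 0 else a i)⁻¹

/-- `(1/a_0) ∑_{s ≥ 0} ∑_{j=s+1}^{k+s} a_j ∑_{l=0}^{k+s-j} |ψ_l| a_{k+s-j-l+i}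
  + (1/a_0) ∑_{s ≥ 0} a_{k+s+i}`, with values in `[0, ∞]`. -/
def archBracket (a : ℕ → ℝ) (k i : ℕ) : ℝ≥0∞ :=
  ENNReal.ofReal (1 / a 0) * ∑' s : ℕ, ENNReal.ofReal
      (∑ j ∈ Finset.Icc (s + 1) (k + s), a j *
        ∑ l ∈ Finset.range (k + s - j + 1), |archPsi a l| * a (k + s - j - l + i))
    + ENNReal.ofReal (1 / a 0) * ∑' s : ℕ, ENNReal.ofReal (a (k + s + i))

/-- `K(ν) = 3 (ν^{1/(1+ν)} + ν^{-ν/(ν+1)})`. -/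
def archK (ν : ℝ) : ℝ := 3 * (ν ^ (1 / (1 + ν)) + ν ^ (-(ν / (ν + 1))))

/-- The mixing bound `K(ν) (1 + L)^{ν/(ν+1)} ∑_{i ≥ 0} [bracket_i]^{ν/(ν+1)} M^{1/(ν+1)}`, where
`M` is the `ν`-th absolute moment of the process and `L` the constant in the dilation condition
on the innovation density. It may be infinite. -/
def archMixingBound (a : ℕ → ℝ) (ν M : ℝ) (L : ℝ≥0) (k : ℕ) : ℝ≥0∞ :=
  ENNReal.ofReal (archK ν * (1 + L) ^ (ν / (ν + 1))) *
    ∑' i : ℕ, archBracket a k i ^ (ν / (ν + 1)) * ENNReal.ofReal (M ^ (1 / (ν + 1)))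

/-- The mixing coefficients `c k` obey the series bound for all `k ≥ 1`, the polynomial rate when
the `a_j` and `ψ_j` decay like `j^{-γ}`, and the geometric rate when they decay like `ρ^j`. -/
def ArchMixingRates (a : ℕ → ℝ) (ν M : ℝ) (L : ℝ≥0) (c : ℕ → ℝ≥0∞) : Prop :=
  (∀ k : ℕ, 1 ≤ k → c k ≤ archMixingBound a ν M L k) ∧
  (∀ γ : ℝ, a =O[atTop] (fun j : ℕ => (j : ℝ) ^ (-γ)) →
    archPsi a =O[atTop] (fun j : ℕ => (j : ℝ) ^ (-γ)) →
    ∃ K : ℝ, ∀ k : ℕ, 1 ≤ k → c k ≤ ENNReal.ofReal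
      (K * (k * ((k : ℝ) + 1) ^ (-(γ * (ν / (ν + 1))) + 3)
        + ((k : ℝ) + 1) ^ (-(γ * (ν / (ν + 1))) + 2)))) ∧
  (∀ ρ : ℝ, 0 < ρ → ρ < 1 → a =O[atTop] (fun j : ℕ => ρ ^ j) →
    archPsi a =O[atTop] (fun j : ℕ => ρ ^ j) →
    ∃ C : ℝ, ∀ k : ℕ, 1 ≤ k → c k ≤ ENNReal.ofReal (C * k * ρ ^ ((k : ℝ) / 2)))

end

/-!
Everything follows from one bound on `β(k)` under the weaker condition `DilationLipschitz`: the
condition `SupDilationLipschitz` implies it, and `α(k) ≤ β(k)` because an event and its complement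
form a partition.

The history `h_t = (X_t, X_{t-1}, …)` is a Markov chain. With `σ(h) = a₀ + ∑_{j ≥ 1} a_j h_{j-1}`,
its transfer operator is `(Tψ)(h) = E ψ(Zσ(h), h)`, so a bounded function `ψ(h_{t+n})` has
conditional expectation `(Tⁿψ)(h_t)` given the past (`IsSqARCHInfty.setIntegral_hist_add`). The
covariance of such a function with an event of the past is therefore controlled by the oscillation
of `Tⁿψ` between `h_t` and an independent copy of it (`edist_setIntegral_le_copyDist`).

Let `ψ` depend on `X_{t+k}, …, X_{t+k+r}` only. Two effects are estimated separately.

* Over the stretch seen by `ψ`, one new value at a time is exchanged. By the dilation condition the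
  laws of `Zσ` and `Zσ'` are at distance at most `(1 + L)|σ - σ'|/a₀`, and for histories `h, h'`
  followed by `s` common values the scales differ by at most `∑_j a_{j+1+s}|h_j - h'_j|`, which does
  not involve these values. Summation over `s` gives `edist_archTransfer_iterate_le`, uniformly in
  `r`.
* Over the `k - 1` steps before it, both histories receive the same innovations. As `E Z = 1`, one
  step turns a Lipschitz bound `∑_j w_j|h_j - h'_j|` into the one with weights
  `w₀ a_{j+1} + w_{j+1}` (`edist_archTransfer_le`). Iterating this linear recursion is a renewal
  equation with solution `ψ_l`, and the resulting weights are bounded by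
  `(1 + L) * archBracket a k i` (`weightStep_iterate_le_archBracket`).

Functions of the whole future are reached by Lévy's upward theorem
(`IsSqARCHInfty.edist_future_le`). Since the oscillation is also at most `2`, it remains to bound
`E min(2, ∑_i w_i|x_i - x'_i|)` for independent `x, x'`, where `min(2, y) ≤ 2^{1-θ} y^θ` with
`θ = ν/(ν+1)` and Jensen's inequality give the series bound (`copyDist_univ_le`).

The rates are analytic consequences: each bracket is a sum of at most `k²` products of terms whose
indices add up to `k - 1 + i` (`archBracket_le`). When `γν/(ν+1) ≤ 4` the polynomial rate already
follows from `β(k) ≤ 2`.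
-/

/-! ### Histories and scales -/

/-- The history `h` (newest value first) extended by the new value `y`. -/
def consHist (y : ℝ) (h : ℕ → ℝ) : ℕ → ℝ
  | 0 => y
  | j + 1 => h j

@[simp] lemma consHist_zero (y : ℝ) (h : ℕ → ℝ) : consHist y h 0 = y := rfl

@[simp] lemma consHist_succ (y : ℝ) (h : ℕ → ℝ) (j : ℕ) : consHist y h (j + 1) = h j := rfl

lemma measurable_consHist : Measurable fun p : ℝ × (ℕ → ℝ) => consHist p.1 p.2 := by
  refine measurable_pi_lambda _ fun j => ?_
  cases j with
  | zero => exact measurable_fst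
  | succ j => exact (measurable_pi_apply j).comp measurable_snd

/-- The scale `a₀ + ∑_{j ≥ 1} a_j h_{j-1}` of the next value after the history `h`. The series is
summed in `[0, ∞]`, so that the scale is measurable and at least `a₀` for every history. -/
noncomputable def archScale (a : ℕ → ℝ) (h : ℕ → ℝ) : ℝ :=
  a 0 + (∑' j, ENNReal.ofReal (a (j + 1) * h j)).toReal

lemma measurable_archScale (a : ℕ → ℝ) : Measurable (archScale a) := by
  refine measurable_const.add (ENNReal.measurable_toReal.comp ?_)
  exact Measurable.tsum fun j =>
    ENNReal.measurable_ofReal.comp (measurable_const.mul (measurable_pi_apply j))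

lemma le_archScale (a : ℕ → ℝ) (h : ℕ → ℝ) : a 0 ≤ archScale a h := by
  unfold archScale; linarith [ENNReal.toReal_nonneg (a := ∑' j, ENNReal.ofReal (a (j + 1) * h j))]

/-- The weighted `ℓ¹` distance `∑_j w_j |h_j - h'_j|` of two histories. -/
noncomputable def histDist (w : ℕ → ℝ≥0∞) (h h' : ℕ → ℝ) : ℝ≥0∞ :=
  ∑' j, w j * edist (h j) (h' j)

lemma histDist_comm (w : ℕ → ℝ≥0∞) (h h' : ℕ → ℝ) : histDist w h h' = histDist w h' h := by
  simp only [histDist, edist_comm]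

lemma histDist_consHist (w : ℕ → ℝ≥0∞) (y y' : ℝ) (h h' : ℕ → ℝ) :
    histDist w (consHist y h) (consHist y' h')
      = w 0 * edist y y' + histDist (fun j => w (j + 1)) h h' := by
  unfold histDist
  rw [tsum_eq_zero_add' ENNReal.summable]
  simp

lemma ofReal_mul_le_add_edist {c : ℝ} (hc : 0 ≤ c) (x y : ℝ) :
    ENNReal.ofReal (c * x) ≤ ENNReal.ofReal (c * y) + ENNReal.ofReal c * edist x y := by
  rw [edist_dist, ← ENNReal.ofReal_mul hc, Real.dist_eq]
  refine le_trans (ENNReal.ofReal_le_ofReal ?_) ENNReal.ofReal_add_le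
  have := le_abs_self (x - y)
  nlinarith

lemma edist_toReal_le {x y W : ℝ≥0∞} (h1 : x ≤ y + W) (h2 : y ≤ x + W) :
    edist x.toReal y.toReal ≤ W := by
  by_cases hW : W = ∞
  · simp [hW]
  by_cases hx : x = ∞
  · have hy : y = ∞ := by
      by_contra hy
      exact (ENNReal.add_lt_top.2 ⟨lt_top_iff_ne_top.2 hy, lt_top_iff_ne_top.2 hW⟩).ne
        (top_le_iff.1 (hx ▸ h1))
    simp [hx, hy]
  have hy : y ≠ ∞ := fun hy =>
    (ENNReal.add_lt_top.2 ⟨lt_top_iff_ne_top.2 hx, lt_top_iff_ne_top.2 hW⟩).ne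
      (top_le_iff.1 (hy ▸ h2))
  lift x to ℝ≥0 using hx
  lift y to ℝ≥0 using hy
  lift W to ℝ≥0 using hW
  have h1' : (x : ℝ) ≤ y + W := by exact_mod_cast h1
  have h2' : (y : ℝ) ≤ x + W := by exact_mod_cast h2
  rw [edist_dist, Real.dist_eq, ← ENNReal.ofReal_coe_nnreal (p := W)]
  refine ENNReal.ofReal_le_ofReal ?_
  rw [abs_le]
  simp only [ENNReal.coe_toReal]
  constructor <;> linarith

lemma edist_archScale_le {a : ℕ → ℝ} (ha : ∀ j, 0 ≤ a j) (h h' : ℕ → ℝ) :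
    edist (archScale a h) (archScale a h')
      ≤ histDist (fun j => ENNReal.ofReal (a (j + 1))) h h' := by
  unfold archScale
  rw [edist_add_left]
  have key : ∀ h h' : ℕ → ℝ, ∑' j, ENNReal.ofReal (a (j + 1) * h j)
      ≤ ∑' j, ENNReal.ofReal (a (j + 1) * h' j)
        + histDist (fun j => ENNReal.ofReal (a (j + 1))) h h' := fun h h' => by
    unfold histDist
    rw [← ENNReal.tsum_add]
    exact ENNReal.tsum_le_tsum fun j => ofReal_mul_le_add_edist (ha _) _ _
  exact edist_toReal_le (key h h') (histDist_comm _ h h' ▸ key h' h)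

/-! ### The transfer operator -/

/-- A measurable function on histories with values in `[-1, 1]`. -/
structure IsTest (ψ : (ℕ → ℝ) → ℝ) : Prop where
  measurable : Measurable ψ
  abs_le : ∀ h, |ψ h| ≤ 1

/-- The transfer operator of the process: if `μ` is the law of the innovations, it maps `ψ` to the
conditional expectation of `ψ` at the next history, given the current history. -/
noncomputable def archTransfer (a : ℕ → ℝ) (μ : Measure ℝ) (ψ : (ℕ → ℝ) → ℝ) (h : ℕ → ℝ) : ℝ :=
  ∫ z, ψ (consHist (z * archScale a h) h) ∂μ

lemma measurable_nextHist (a : ℕ → ℝ) : Measurable fun p : (ℕ → ℝ) × ℝ =>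
    consHist (p.2 * archScale a p.1) p.1 :=
  measurable_consHist.comp ((measurable_snd.mul
    ((measurable_archScale a).comp measurable_fst)).prodMk measurable_fst)

lemma IsTest.archTransfer {a : ℕ → ℝ} {μ : Measure ℝ} [IsProbabilityMeasure μ]
    {ψ : (ℕ → ℝ) → ℝ} (hψ : IsTest ψ) : IsTest (archTransfer a μ ψ) where
  measurable := by
    have := (hψ.measurable.comp (measurable_nextHist a)).stronglyMeasurable
    exact (this.integral_prod_right' (ν := μ)).measurable
  abs_le h := by
    have := norm_integral_le_of_norm_le_const (μ := μ) (C := 1)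
      (f := fun z => ψ (consHist (z * archScale a h) h)) (ae_of_all _ fun z => hψ.abs_le _)
    simpa [_root_.archTransfer] using this

lemma IsTest.archTransfer_iterate {a : ℕ → ℝ} {μ : Measure ℝ} [IsProbabilityMeasure μ]
    {ψ : (ℕ → ℝ) → ℝ} (hψ : IsTest ψ) (n : ℕ) : IsTest ((_root_.archTransfer a μ)^[n] ψ) := by
  induction n with
  | zero => exact hψ
  | succ n ih => rw [Function.iterate_succ_apply']; exact ih.archTransfer

lemma IsTest.integrable_comp {ψ : (ℕ → ℝ) → ℝ} (hψ : IsTest ψ) {α : Type*} [MeasurableSpace α]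
    {μ : Measure α} [IsFiniteMeasure μ] {F : α → ℕ → ℝ} (hF : Measurable F) :
    Integrable (fun x => ψ (F x)) μ :=
  Integrable.of_bound (hψ.measurable.comp hF).aestronglyMeasurable 1
    (ae_of_all _ fun _ => hψ.abs_le _)

lemma edist_integral_le {α : Type*} [MeasurableSpace α] {μ : Measure α} {F G : α → ℝ}
    (hF : Integrable F μ) (hG : Integrable G μ) :
    edist (∫ x, F x ∂μ) (∫ x, G x ∂μ) ≤ ∫⁻ x, edist (F x) (G x) ∂μ := by
  rw [edist_eq_enorm_sub, ← integral_sub hF hG]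
  refine (enorm_integral_le_lintegral_enorm _).trans (le_of_eq ?_)
  simp only [edist_eq_enorm_sub]

lemma measurable_consHist_left (h : ℕ → ℝ) : Measurable fun y : ℝ => consHist y h :=
  measurable_consHist.comp (measurable_id.prodMk measurable_const)

/-- One step of the transfer operator, with the same innovation after both histories, turns the
Lipschitz weights `w` into `w₀ a_{j+1} + w_{j+1}`, because the innovations have mean one. -/
lemma edist_archTransfer_le {a : ℕ → ℝ} (ha : ∀ j, 0 ≤ a j) {μ : Measure ℝ}
    [IsProbabilityMeasure μ] (hμ : ∫⁻ z, ‖z‖ₑ ∂μ = 1) {ψ : (ℕ → ℝ) → ℝ} (hψ : IsTest ψ)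
    {w : ℕ → ℝ≥0∞} (hw : ∀ h h', edist (ψ h) (ψ h') ≤ histDist w h h') (h h' : ℕ → ℝ) :
    edist (archTransfer a μ ψ h) (archTransfer a μ ψ h')
      ≤ histDist (fun j => w 0 * ENNReal.ofReal (a (j + 1)) + w (j + 1)) h h' := by
  have hm : ∀ h : ℕ → ℝ, Measurable fun z : ℝ => consHist (z * archScale a h) h := fun h =>
    (measurable_consHist_left h).comp (measurable_id.mul_const _)
  calc edist (archTransfer a μ ψ h) (archTransfer a μ ψ h')
      ≤ ∫⁻ z, edist (ψ (consHist (z * archScale a h) h))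
          (ψ (consHist (z * archScale a h') h')) ∂μ :=
        edist_integral_le (hψ.integrable_comp (hm h)) (hψ.integrable_comp (hm h'))
    _ ≤ ∫⁻ z, ‖z‖ₑ * (w 0 * edist (archScale a h) (archScale a h'))
          + histDist (fun j => w (j + 1)) h h' ∂μ := by
        refine lintegral_mono fun z => (hw _ _).trans (le_of_eq ?_)
        rw [histDist_consHist]
        congr 1
        rw [edist_eq_enorm_sub, ← mul_sub, enorm_mul, edist_eq_enorm_sub]
        ring
    _ = w 0 * edist (archScale a h) (archScale a h') + histDist (fun j => w (j + 1)) h h' := by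
        rw [lintegral_add_right _ measurable_const, lintegral_mul_const _ measurable_enorm, hμ]
        simp
    _ ≤ w 0 * histDist (fun j => ENNReal.ofReal (a (j + 1))) h h'
          + histDist (fun j => w (j + 1)) h h' := by
        gcongr; exact edist_archScale_le ha h h'
    _ = _ := by
        unfold histDist
        rw [← ENNReal.tsum_mul_left, ← ENNReal.tsum_add]
        refine tsum_congr fun j => ?_
        ring

/-! ### Total variation distance of dilated laws -/

lemma integral_withDensity_ofReal {f : ℝ → ℝ} (hf : Measurable f) (hf0 : ∀ u, 0 ≤ f u)
    (g : ℝ → ℝ) : ∫ z, g z ∂(volume.withDensity fun u => ENNReal.ofReal (f u))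
      = ∫ z, f z * g z := by
  have : (fun u => ENNReal.ofReal (f u)) = fun u => ((f u).toNNReal : ℝ≥0∞) := rfl
  rw [this, integral_withDensity_eq_integral_smul hf.real_toNNReal]
  refine integral_congr_ae (ae_of_all _ fun z => ?_)
  simp [NNReal.smul_def, hf0 z]

/-- The laws of `s Z` and `s (1 + c) Z` differ by at most `(1 + L) c` in total variation: `L c` by
the dilation condition, and `c` by the change of the normalising constant of the density. -/
lemma edist_integral_dilation_le {f : ℝ → ℝ} {L : ℝ≥0} (hf : Measurable f) (hf0 : ∀ u, 0 ≤ f u)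
    (hf1 : ∫⁻ u, ENNReal.ofReal (f u) = 1) (hL : DilationLipschitz f L)
    {g : ℝ → ℝ} (hg : Measurable g) (hg1 : ∀ y, |g y| ≤ 1) (s : ℝ) {c : ℝ} (hc : 0 < c) :
    edist (∫ z, f z * g (z * s)) (∫ z, f z * g (z * (s * (1 + c))))
      ≤ (1 + L) * ENNReal.ofReal c := by
  have hc1 : 0 < 1 + c := by linarith
  have hfi : Integrable f := by
    refine ⟨hf.aestronglyMeasurable, ?_⟩
    rw [HasFiniteIntegral]
    simp_rw [Real.enorm_eq_ofReal (hf0 _), hf1]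
    exact ENNReal.one_lt_top
  have hfm : Measurable fun u => f (u * (1 + c)) := hf.comp (measurable_id.mul_const _)
  have hfi' : Integrable fun u => f (u * (1 + c)) := hfi.comp_mul_right' hc1.ne'
  -- the substitution `z = u (1 + c)` in the first integral gives both the same argument of `g`
  have hsub : ∫ z, f z * g (z * s) = ∫ u, (1 + c) * f (u * (1 + c)) * g (u * (s * (1 + c))) := by
    have := Measure.integral_comp_mul_right (fun z => f z * g (z * s)) (1 + c)
    rw [abs_of_pos (inv_pos.2 hc1), smul_eq_mul] at this
    have h2 : ∫ z, f z * g (z * s)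
        = (1 + c) * ∫ u, f (u * (1 + c)) * g (u * (1 + c) * s) := by
      rw [this, mul_inv_cancel_left₀ hc1.ne']
    rw [h2, ← integral_const_mul]
    refine integral_congr_ae (ae_of_all _ fun u => ?_)
    simp only
    rw [show u * (1 + c) * s = u * (s * (1 + c)) by ring]; ring
  have hgm : Measurable fun u : ℝ => g (u * (s * (1 + c))) := hg.comp (measurable_id.mul_const _)
  have hgb : ∀ᵐ u : ℝ, ‖g (u * (s * (1 + c)))‖ ≤ 1 := ae_of_all _ fun u => hg1 _
  have i1 : Integrable fun u => (1 + c) * f (u * (1 + c)) * g (u * (s * (1 + c))) :=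
    (hfi'.const_mul _).mul_bdd hgm.aestronglyMeasurable hgb
  have i2 : Integrable fun u => f u * g (u * (s * (1 + c))) :=
    hfi.mul_bdd hgm.aestronglyMeasurable hgb
  rw [hsub]
  have hmass : ∫⁻ u, ENNReal.ofReal (c * f (u * (1 + c))) ≤ ENNReal.ofReal c := by
    have h1 : ∫⁻ u, ENNReal.ofReal (f (u * (1 + c))) ≤ 1 := by
      rw [← ofReal_integral_eq_lintegral_ofReal hfi' (ae_of_all _ fun u => hf0 _)]
      rw [Measure.integral_comp_mul_right f (1 + c), abs_of_pos (inv_pos.2 hc1), smul_eq_mul]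
      have h3 : ∫ u, f u = 1 := by
        rw [integral_eq_lintegral_of_nonneg_ae (ae_of_all _ hf0) hf.aestronglyMeasurable, hf1]
        simp
      rw [h3, mul_one, ← ENNReal.ofReal_one]
      exact ENNReal.ofReal_le_ofReal (inv_le_one_of_one_le₀ (by linarith))
    simp_rw [ENNReal.ofReal_mul hc.le]
    rw [lintegral_const_mul _ (hfm.ennreal_ofReal)]
    exact mul_le_of_le_one_right' h1
  calc edist (∫ u, (1 + c) * f (u * (1 + c)) * g (u * (s * (1 + c))))
        (∫ u, f u * g (u * (s * (1 + c))))
      ≤ ∫⁻ u, edist ((1 + c) * f (u * (1 + c)) * g (u * (s * (1 + c))))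
          (f u * g (u * (s * (1 + c)))) := edist_integral_le i1 i2
    _ ≤ ∫⁻ u, ENNReal.ofReal |f u - f (u * (1 + c))| + ENNReal.ofReal (c * f (u * (1 + c))) := by
        refine lintegral_mono fun u => ?_
        rw [edist_dist, Real.dist_eq,
          ← ENNReal.ofReal_add (abs_nonneg _) (mul_nonneg hc.le (hf0 _)), ← sub_mul, abs_mul]
        refine ENNReal.ofReal_le_ofReal ((mul_le_of_le_one_right (abs_nonneg _) (hg1 _)).trans ?_)
        rw [show (1 + c) * f (u * (1 + c)) - f u
          = -(f u - f (u * (1 + c))) + c * f (u * (1 + c)) by ring]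
        refine (abs_add_le _ _).trans (le_of_eq ?_)
        rw [abs_neg, abs_of_nonneg (mul_nonneg hc.le (hf0 _))]
    _ ≤ L * ENNReal.ofReal c + ENNReal.ofReal c := by
        rw [lintegral_add_right _ (hfm.const_mul c).ennreal_ofReal]
        exact add_le_add (hL c hc) hmass
    _ = _ := by ring

lemma edist_integral_scale_le {f : ℝ → ℝ} {L : ℝ≥0} (hf : Measurable f) (hf0 : ∀ u, 0 ≤ f u)
    (hf1 : ∫⁻ u, ENNReal.ofReal (f u) = 1) (hL : DilationLipschitz f L)
    {g : ℝ → ℝ} (hg : Measurable g) (hg1 : ∀ y, |g y| ≤ 1) {b : ℝ} (hb : 0 < b) {s s' : ℝ}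
    (hs : b ≤ s) (hs' : b ≤ s') :
    edist (∫ z, f z * g (z * s)) (∫ z, f z * g (z * s'))
      ≤ (1 + L) * ENNReal.ofReal (1 / b) * edist s s' := by
  wlog hss : s ≤ s' generalizing s s'
  · rw [edist_comm, edist_comm s]
    exact this hs' hs (le_of_not_ge hss)
  rcases hss.eq_or_lt with rfl | hlt
  · simp
  have hs0 : 0 < s := hb.trans_le hs
  have hc : 0 < (s' - s) / s := div_pos (by linarith) hs0
  have h1 := edist_integral_dilation_le hf hf0 hf1 hL hg hg1 s hc
  rw [show s * (1 + (s' - s) / s) = s' by field_simp; ring] at h1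
  refine h1.trans ?_
  rw [mul_assoc, ← ENNReal.ofReal_toReal (edist_ne_top s s'), ← ENNReal.ofReal_mul (by positivity)]
  gcongr
  rw [← dist_edist, Real.dist_eq, abs_sub_comm, abs_of_pos (by linarith), div_eq_mul_inv, mul_comm,
    one_div]
  have : 0 ≤ s' - s := by linarith
  gcongr

/-- Total variation bound for the next `n` values. If `ψ` sees only the `n` new values and `m`
values on which `h` and `h'` agree, the innovations can be replaced one at a time; the `s`-th
replacement compares two scales which differ by `∑_j a_{j+1+s} |h_j - h'_j|` at most, whatever the
common values in between. -/
lemma edist_archTransfer_iterate_le {a : ℕ → ℝ} (ha0 : 0 < a 0) (ha : ∀ j, 0 ≤ a j) {f : ℝ → ℝ}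
    {L : ℝ≥0} (hf : Measurable f) (hf0 : ∀ u, 0 ≤ f u) {μ : Measure ℝ} [IsProbabilityMeasure μ]
    (hμ : μ = volume.withDensity fun u => ENNReal.ofReal (f u)) (hL : DilationLipschitz f L)
    {ψ : (ℕ → ℝ) → ℝ} (hψ : IsTest ψ) (n m : ℕ)
    (hdep : ∀ h h' : ℕ → ℝ, (∀ i < n + m, h i = h' i) → ψ h = ψ h')
    (h h' : ℕ → ℝ) (hh : ∀ i < m, h i = h' i) :
    edist ((archTransfer a μ)^[n] ψ h) ((archTransfer a μ)^[n] ψ h')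
      ≤ ∑ s ∈ Finset.range n, (1 + L) * ENNReal.ofReal (1 / a 0)
          * histDist (fun j => ENNReal.ofReal (a (j + 1 + s))) h h' := by
  have hf1 : ∫⁻ u, ENNReal.ofReal (f u) = 1 := by
    have := measure_univ (μ := μ)
    rwa [hμ, withDensity_apply _ MeasurableSet.univ, Measure.restrict_univ] at this
  induction n generalizing m h h' with
  | zero => simp [hdep h h' (by simpa using hh)]
  | succ n ih =>
    rw [Function.iterate_succ_apply']
    set φ := (archTransfer a μ)^[n] ψ with hφdef
    have hφ : IsTest φ := hψ.archTransfer_iterate n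
    have hm : ∀ (r : ℝ) (h : ℕ → ℝ), Measurable fun z : ℝ => consHist (z * r) h := fun r h =>
      (measurable_consHist_left h).comp (measurable_id.mul_const _)
    set C : ℝ≥0∞ := (1 + L) * ENNReal.ofReal (1 / a 0)
    have hnew : edist (∫ z, φ (consHist (z * archScale a h) h) ∂μ)
        (∫ z, φ (consHist (z * archScale a h) h') ∂μ)
        ≤ ∑ s ∈ Finset.range n,
          C * histDist (fun j => ENNReal.ofReal (a (j + 1 + (s + 1)))) h h' := by
      refine (edist_integral_le (hφ.integrable_comp (hm _ _))
        (hφ.integrable_comp (hm _ _))).trans ?_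
      refine (lintegral_mono (g := fun _ => ∑ s ∈ Finset.range n,
        C * histDist (fun j => ENNReal.ofReal (a (j + 1 + (s + 1)))) h h') fun z => ?_).trans
          (by simp)
      refine (ih (m + 1) (fun u u' hu => hdep u u' fun i hi => hu i (by omega)) _ _ ?_).trans
        (le_of_eq ?_)
      · intro i hi
        cases i with
        | zero => rfl
        | succ i => exact hh i (by omega)
      · refine Finset.sum_congr rfl fun s _ => ?_
        rw [histDist_consHist]
        simp only [edist_self, mul_zero, zero_add]
        simp only [add_comm, add_left_comm]
    have hold : edist (∫ z, φ (consHist (z * archScale a h) h') ∂μ)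
        (∫ z, φ (consHist (z * archScale a h') h') ∂μ)
        ≤ C * histDist (fun j => ENNReal.ofReal (a (j + 1))) h h' := by
      rw [hμ, integral_withDensity_ofReal hf hf0, integral_withDensity_ofReal hf hf0]
      refine (edist_integral_scale_le hf hf0 hf1 hL
        (hφ.measurable.comp (measurable_consHist_left h')) (fun y => hφ.abs_le _) ha0
        (le_archScale a h) (le_archScale a h')).trans ?_
      gcongr
      exact edist_archScale_le ha h h'
    rw [Finset.sum_range_succ']
    exact (edist_triangle _ _ _).trans (add_le_add hnew hold)

/-! ### Evolution of Lipschitz weights and the renewal coefficients -/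

/-- The evolution of Lipschitz weights under one step of the transfer operator. -/
noncomputable def weightStep (a : ℕ → ℝ) (w : ℕ → ℝ≥0∞) (j : ℕ) : ℝ≥0∞ :=
  w 0 * ENNReal.ofReal (a (j + 1)) + w (j + 1)

lemma edist_archTransfer_iterate_le_weightStep {a : ℕ → ℝ} (ha : ∀ j, 0 ≤ a j) {μ : Measure ℝ}
    [IsProbabilityMeasure μ] (hμ : ∫⁻ z, ‖z‖ₑ ∂μ = 1) {ψ : (ℕ → ℝ) → ℝ} (hψ : IsTest ψ)
    {w : ℕ → ℝ≥0∞} (hw : ∀ h h', edist (ψ h) (ψ h') ≤ histDist w h h') (m : ℕ) (h h' : ℕ → ℝ) :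
    edist ((archTransfer a μ)^[m] ψ h) ((archTransfer a μ)^[m] ψ h')
      ≤ histDist ((weightStep a)^[m] w) h h' := by
  induction m generalizing h h' with
  | zero => exact hw h h'
  | succ m ih =>
    simp only [Function.iterate_succ_apply']
    exact edist_archTransfer_le ha hμ (hψ.archTransfer_iterate m) ih h h'

/-- The defining recursion of the coefficients `ψ_p`. -/
lemma archPsi_eq_sum (a : ℕ → ℝ) {p : ℕ} (hp : p ≠ 0) :
    archPsi a p = ∑ l ∈ Finset.range p, archPsi a l * a (p - l) := by
  set F : PowerSeries ℝ := 1 - PowerSeries.mk fun i => if i = 0 then 0 else a i with hF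
  have hc : PowerSeries.constantCoeff F ≠ 0 := by
    simp [hF, PowerSeries.constantCoeff_mk]
  have hmul : F⁻¹ * (PowerSeries.mk fun i => if i = 0 then 0 else a i) = F⁻¹ - 1 := by
    have := PowerSeries.inv_mul_cancel F hc
    have h2 : (PowerSeries.mk fun i => if i = 0 then 0 else a i) = 1 - F := by rw [hF]; ring
    rw [h2, mul_sub, mul_one, this]
  have h := congrArg (PowerSeries.coeff p) hmul
  rw [PowerSeries.coeff_mul, Finset.Nat.sum_antidiagonal_eq_sum_range_succ_mk,
    Finset.sum_range_succ] at h
  simp only [PowerSeries.coeff_mk, tsub_self, if_true, mul_zero, add_zero, map_sub,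
    PowerSeries.coeff_one, if_neg hp, sub_zero] at h
  unfold archPsi
  rw [← hF, ← h]
  refine Finset.sum_congr rfl fun l hl => ?_
  rw [if_neg (by have := Finset.mem_range.1 hl; omega)]

/-- The truncated convolution `∑_{l < p} |ψ_l| a_{p-l+j}`. -/
noncomputable def psiConv (a : ℕ → ℝ) (p j : ℕ) : ℝ :=
  ∑ l ∈ Finset.range p, |archPsi a l| * a (p - l + j)

lemma psiConv_nonneg {a : ℕ → ℝ} (ha : ∀ j, 0 ≤ a j) (p j : ℕ) : 0 ≤ psiConv a p j :=
  Finset.sum_nonneg fun _ _ => mul_nonneg (abs_nonneg _) (ha _)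

lemma psiConv_succ (a : ℕ → ℝ) (p j : ℕ) :
    psiConv a (p + 1) j = |archPsi a p| * a (j + 1) + psiConv a p (j + 1) := by
  unfold psiConv
  rw [Finset.sum_range_succ, add_comm]
  congr 1
  · rw [show p + 1 - p + j = j + 1 by omega]
  · refine Finset.sum_congr rfl fun l hl => ?_
    have := Finset.mem_range.1 hl
    rw [show p + 1 - l + j = p - l + (j + 1) by omega]

lemma archPsi_zero (a : ℕ → ℝ) : archPsi a 0 = 1 := by
  simp [archPsi, PowerSeries.constantCoeff_mk]

lemma archPsi_nonneg {a : ℕ → ℝ} (ha : ∀ j, 0 ≤ a j) (p : ℕ) : 0 ≤ archPsi a p := by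
  induction p using Nat.strong_induction_on with
  | _ p ih =>
    rcases eq_or_ne p 0 with rfl | hp
    · simp [archPsi_zero]
    · rw [archPsi_eq_sum a hp]
      exact Finset.sum_nonneg fun l hl => mul_nonneg (ih l (Finset.mem_range.1 hl)) (ha _)

lemma psiConv_zero_right {a : ℕ → ℝ} (ha : ∀ j, 0 ≤ a j) {p : ℕ} (hp : p ≠ 0) :
    psiConv a p 0 = |archPsi a p| := by
  rw [abs_of_nonneg (archPsi_nonneg ha p), archPsi_eq_sum a hp]
  refine Finset.sum_congr rfl fun l _ => ?_
  rw [abs_of_nonneg (archPsi_nonneg ha l), add_zero]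

/-- Closed form of the iterated weights: the recursion for the weight of the newest value is the
renewal equation solved by the `ψ_l`. -/
lemma weightStep_iterate {a : ℕ → ℝ} (ha : ∀ j, 0 ≤ a j) (w : ℕ → ℝ≥0∞) (m j : ℕ) :
    (weightStep a)^[m] w j = w (j + m)
      + ∑ q ∈ Finset.range m, w q * ENNReal.ofReal (psiConv a (m - q) j) := by
  induction m generalizing j with
  | zero => simp
  | succ m ih =>
    rw [Function.iterate_succ_apply', weightStep, ih, ih, Finset.sum_range_succ, zero_add,
      Nat.add_sub_cancel_left, psiConv_succ]
    have h1 : psiConv a 0 (j + 1) = 0 := by simp [psiConv]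
    rw [h1, archPsi_zero, abs_one, one_mul, add_zero, add_mul, Finset.sum_mul,
      show j + 1 + m = j + (m + 1) by omega]
    have h2 : ∑ q ∈ Finset.range m, w q * ENNReal.ofReal (psiConv a (m + 1 - q) j)
        = ∑ q ∈ Finset.range m, w q * ENNReal.ofReal (psiConv a (m - q) 0)
            * ENNReal.ofReal (a (j + 1))
          + ∑ q ∈ Finset.range m, w q * ENNReal.ofReal (psiConv a (m - q) (j + 1)) := by
      rw [← Finset.sum_add_distrib]
      refine Finset.sum_congr rfl fun q hq => ?_
      have hq := Finset.mem_range.1 hq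
      rw [show m + 1 - q = m - q + 1 by omega, psiConv_succ,
        ENNReal.ofReal_add (mul_nonneg (abs_nonneg _) (ha _)) (psiConv_nonneg ha _ _),
        ENNReal.ofReal_mul (abs_nonneg _), psiConv_zero_right ha (by omega)]
      ring
    rw [h2]
    ring

/-- The tail sum `∑_{s ≥ 0} a_{q+1+s}`, in `[0, ∞]`. -/
noncomputable def archTail (a : ℕ → ℝ) (q : ℕ) : ℝ≥0∞ := ∑' s : ℕ, ENNReal.ofReal (a (q + 1 + s))

lemma archBracket_eq {a : ℕ → ℝ} (ha : ∀ j, 0 ≤ a j) (m i : ℕ) :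
    archBracket a (m + 1) i = ENNReal.ofReal (1 / a 0) *
      (∑ q ∈ Finset.range (m + 1), archTail a q * ENNReal.ofReal
          (∑ l ∈ Finset.range (m - q + 1), |archPsi a l| * a (m - q - l + i))
        + archTail a (m + i)) := by
  unfold archBracket
  rw [mul_add]
  congr 2
  · simp_rw [archTail, ← ENNReal.tsum_mul_right]
    rw [← Summable.tsum_finsetSum fun _ _ => ENNReal.summable]
    refine tsum_congr fun s => ?_
    rw [ENNReal.ofReal_sum_of_nonneg fun j _ => mul_nonneg (ha _)
      (Finset.sum_nonneg fun l _ => mul_nonneg (abs_nonneg _) (ha _))]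
    rw [show Finset.Icc (s + 1) (m + 1 + s) = Finset.Ico (s + 1) (s + 1 + (m + 1)) by
      ext; simp only [Finset.mem_Icc, Finset.mem_Ico]; omega, Finset.sum_Ico_eq_sum_range]
    rw [Nat.add_sub_cancel_left]
    refine Finset.sum_congr rfl fun q hq => ?_
    have hq := Finset.mem_range.1 hq
    rw [ENNReal.ofReal_mul (ha _), show q + 1 + s = s + 1 + q by omega,
      show m + 1 + s - (s + 1 + q) = m - q by omega]
  · unfold archTail
    refine tsum_congr fun s => ?_
    rw [show m + 1 + s + i = m + i + 1 + s by omega]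

/-- After `m` steps the weights which start from the tail sums are bounded by the bracket at
`k = m + 1`. -/
lemma weightStep_iterate_le_archBracket {a : ℕ → ℝ} (ha : ∀ j, 0 ≤ a j) (L : ℝ≥0) (m i : ℕ) :
    (weightStep a)^[m] (fun j => (1 + L) * ENNReal.ofReal (1 / a 0) * archTail a j) i
      ≤ (1 + L) * archBracket a (m + 1) i := by
  rw [weightStep_iterate ha, archBracket_eq ha]
  simp_rw [mul_assoc, ← Finset.mul_sum, ← mul_add]
  gcongr _ * (_ * ?_)
  rw [add_comm, add_comm i m, Finset.sum_range_succ]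
  gcongr
  refine le_add_right (Finset.sum_le_sum fun q _ => ?_)
  gcongr
  unfold psiConv
  refine Finset.sum_le_sum_of_subset_of_nonneg (Finset.range_subset_range.2 (by omega))
    fun l _ _ => mul_nonneg (abs_nonneg _) (ha _)

/-! ### Decay rates of the series bound -/

/-- The bracket decays like `k² v(k - 1 + i)` if `a_j`, `ψ_j` and the tails of `a` are dominated by
an envelope `v` with `v_x v_y ≤ v_{x+y}`. -/
lemma archBracket_le {a : ℕ → ℝ} (ha0 : 0 < a 0) (ha : ∀ j, 0 ≤ a j) {v : ℕ → ℝ}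
    (hv0 : ∀ j, 0 ≤ v j) (hv : ∀ x y, v x * v y ≤ v (x + y)) {C : ℝ} (hC : 0 ≤ C)
    (hav : ∀ j, a j ≤ C * v j) (hψv : ∀ j, |archPsi a j| ≤ C * v j)
    (htail : ∀ q, archTail a q ≤ ENNReal.ofReal (C * v q)) (m i : ℕ) :
    archBracket a (m + 1) i
      ≤ ENNReal.ofReal ((C ^ 3 + C) / a 0 * ((m : ℝ) + 1) ^ 2 * v (m + i)) := by
  have hin : ∀ q ∈ Finset.range (m + 1), archTail a q * ENNReal.ofReal
      (∑ l ∈ Finset.range (m - q + 1), |archPsi a l| * a (m - q - l + i))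
      ≤ ENNReal.ofReal (((m : ℝ) + 1) * (C ^ 3 * v (m + i))) := by
    intro q hq
    have hq := Finset.mem_range.1 hq
    calc _ ≤ ENNReal.ofReal (C * v q) * ENNReal.ofReal
          (∑ l ∈ Finset.range (m - q + 1), |archPsi a l| * a (m - q - l + i)) := by
          gcongr; exact htail q
      _ = ENNReal.ofReal (∑ l ∈ Finset.range (m - q + 1),
            C * v q * (|archPsi a l| * a (m - q - l + i))) := by
          rw [← ENNReal.ofReal_mul (mul_nonneg hC (hv0 _)), Finset.mul_sum]
      _ ≤ _ := by
          refine ENNReal.ofReal_le_ofReal ?_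
          have hterm : ∀ l ∈ Finset.range (m - q + 1),
              C * v q * (|archPsi a l| * a (m - q - l + i)) ≤ C ^ 3 * v (m + i) := by
            intro l hl
            have hl := Finset.mem_range.1 hl
            calc C * v q * (|archPsi a l| * a (m - q - l + i))
                ≤ C * v q * (C * v l * (C * v (m - q - l + i))) := by
                  have := hv0 q
                  have := hv0 l
                  gcongr
                  · exact ha _
                  · exact hψv l
                  · exact hav _
              _ = C ^ 3 * (v q * v l * v (m - q - l + i)) := by ring
              _ ≤ C ^ 3 * v (m + i) := by
                  gcongr
                  calc v q * v l * v (m - q - l + i) ≤ v (q + l) * v (m - q - l + i) := by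
                        have := hv0 (m - q - l + i)
                        gcongr; exact hv _ _
                    _ ≤ v (q + l + (m - q - l + i)) := hv _ _
                    _ = v (m + i) := by congr 1; omega
          refine (Finset.sum_le_card_nsmul _ _ _ hterm).trans ?_
          rw [Finset.card_range, nsmul_eq_mul]
          have h0 : 0 ≤ C ^ 3 * v (m + i) := mul_nonneg (by positivity) (hv0 _)
          gcongr
          have : m - q + 1 ≤ m + 1 := by omega
          exact_mod_cast this
  rw [archBracket_eq ha]
  calc _ ≤ ENNReal.ofReal (1 / a 0) *
        (∑ q ∈ Finset.range (m + 1), ENNReal.ofReal (((m : ℝ) + 1) * (C ^ 3 * v (m + i)))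
          + ENNReal.ofReal (C * v (m + i))) := by
        gcongr with q hq
        · exact hin q hq
        · exact htail _
    _ = ENNReal.ofReal (1 / a 0 * (((m : ℝ) + 1) * (((m : ℝ) + 1) * (C ^ 3 * v (m + i)))
          + C * v (m + i))) := by
        have h0 := hv0 (m + i)
        rw [Finset.sum_const, Finset.card_range, nsmul_eq_mul,
          ENNReal.ofReal_mul (p := 1 / a 0) (by positivity), ENNReal.ofReal_add (by positivity)
          (by positivity), ENNReal.ofReal_mul (p := (m : ℝ) + 1)
          (q := ((m : ℝ) + 1) * (C ^ 3 * v (m + i))) (by positivity)]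
        congr 3
        rw [show ((m : ℝ) + 1) = ((m + 1 : ℕ) : ℝ) by push_cast; rfl, ENNReal.ofReal_natCast]
    _ ≤ _ := by
        refine ENNReal.ofReal_le_ofReal ?_
        have h0 := hv0 (m + i)
        have h1 : C * v (m + i) ≤ ((m : ℝ) + 1) ^ 2 * (C * v (m + i)) :=
          le_mul_of_one_le_left (by positivity)
            (one_le_pow₀ (by linarith [Nat.cast_nonneg (α := ℝ) m]))
        calc _ ≤ 1 / a 0 * (((m : ℝ) + 1) * (((m : ℝ) + 1) * (C ^ 3 * v (m + i)))
              + ((m : ℝ) + 1) ^ 2 * (C * v (m + i))) := by gcongr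
          _ = _ := by ring

lemma archK_nonneg {ν : ℝ} (hν : 1 < ν) : 0 ≤ archK ν := by unfold archK; positivity

/-- If moreover `v(m + i)^{ν/(ν+1)} ≤ b_m u_i` with summable `u`, the series bound is of the order
of `k^{2ν/(ν+1)} b_{k-1}`. -/
lemma archMixingBound_le {a : ℕ → ℝ} (ha0 : 0 < a 0) (ha : ∀ j, 0 ≤ a j) {v : ℕ → ℝ}
    (hv0 : ∀ j, 0 ≤ v j) (hv : ∀ x y, v x * v y ≤ v (x + y)) {C : ℝ} (hC : 0 ≤ C)
    (hav : ∀ j, a j ≤ C * v j) (hψv : ∀ j, |archPsi a j| ≤ C * v j)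
    (htail : ∀ q, archTail a q ≤ ENNReal.ofReal (C * v q)) {ν : ℝ} (hν : 1 < ν) (M : ℝ) (L : ℝ≥0)
    {b u : ℕ → ℝ} (hu : Summable u) (hu0 : ∀ i, 0 ≤ u i) (hb0 : ∀ m, 0 ≤ b m)
    (hbu : ∀ m i, v (m + i) ^ (ν / (ν + 1)) ≤ b m * u i) :
    ∃ E : ℝ, 0 ≤ E ∧ ∀ m : ℕ, archMixingBound a ν M L (m + 1)
      ≤ ENNReal.ofReal (E * (((m : ℝ) + 1) ^ (2 * (ν / (ν + 1))) * b m)) := by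
  set θ := ν / (ν + 1) with hθ
  have hθ0 : 0 < θ := by positivity
  set D := (C ^ 3 + C) / a 0 with hD
  have hD0 : 0 ≤ D := by positivity
  set B := archK ν * (1 + L) ^ θ with hB
  have hB0 : 0 ≤ B := mul_nonneg (archK_nonneg hν) (by positivity)
  -- `M` is an arbitrary real here, so its power is truncated at `0`, as `ENNReal.ofReal` does
  set N := (M ^ (1 / (ν + 1))) ⊔ 0 with hN
  have hN0 : 0 ≤ N := le_max_right _ _
  have hS0 : 0 ≤ ∑' i, u i := tsum_nonneg hu0
  refine ⟨B * (D ^ θ * (∑' i, u i) * N), by positivity, fun m => ?_⟩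
  have hb := hb0 m
  have hterm : ∀ i, archBracket a (m + 1) i ^ θ * ENNReal.ofReal (M ^ (1 / (ν + 1)))
      ≤ ENNReal.ofReal (D ^ θ * (((m : ℝ) + 1) ^ (2 * θ) * b m) * N) * ENNReal.ofReal (u i) := by
    intro i
    have h0 := hv0 (m + i)
    have hui := hu0 i
    calc _ ≤ ENNReal.ofReal (D * ((m : ℝ) + 1) ^ 2 * v (m + i)) ^ θ * ENNReal.ofReal N := by
          gcongr
          · exact archBracket_le ha0 ha hv0 hv hC hav hψv htail m i
          · exact le_max_left _ _
      _ = ENNReal.ofReal (D ^ θ * (((m : ℝ) + 1) ^ (2 * θ) * v (m + i) ^ θ) * N) := by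
          rw [ENNReal.ofReal_rpow_of_nonneg (by positivity) hθ0.le,
            ← ENNReal.ofReal_mul (by positivity), Real.mul_rpow (by positivity) h0,
            Real.mul_rpow hD0 (by positivity), ← Real.rpow_natCast_mul (by positivity)]
          push_cast
          ring_nf
      _ ≤ ENNReal.ofReal (D ^ θ * (((m : ℝ) + 1) ^ (2 * θ) * (b m * u i)) * N) := by
          refine ENNReal.ofReal_le_ofReal ?_
          gcongr
          exact hbu m i
      _ = _ := by
          rw [← ENNReal.ofReal_mul (by positivity)]
          ring_nf
  unfold archMixingBound
  calc _ ≤ ENNReal.ofReal B * ∑' i,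
        ENNReal.ofReal (D ^ θ * (((m : ℝ) + 1) ^ (2 * θ) * b m) * N) * ENNReal.ofReal (u i) := by
        gcongr ENNReal.ofReal B * ∑' i, ?_ with i; exact hterm i
    _ = _ := by
        rw [ENNReal.tsum_mul_left, ← ENNReal.ofReal_tsum_of_nonneg hu0 hu,
          ← ENNReal.ofReal_mul (by positivity), ← ENNReal.ofReal_mul hB0]
        ring_nf

lemma rpow_neg_add_le {r s : ℝ} (hr : 0 ≤ r) (hs : 0 ≤ s) (x y : ℕ) :
    (((x + y : ℕ) : ℝ) + 1) ^ (-(r + s)) ≤ ((x : ℝ) + 1) ^ (-r) * ((y : ℝ) + 1) ^ (-s) := by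
  rw [neg_add, Real.rpow_add (by positivity)]
  have hx : (0 : ℝ) ≤ x := Nat.cast_nonneg x
  have hy : (0 : ℝ) ≤ y := Nat.cast_nonneg y
  gcongr ?_ * ?_
  · exact Real.rpow_le_rpow_of_nonpos (by positivity) (by push_cast; linarith) (by linarith)
  · exact Real.rpow_le_rpow_of_nonpos (by positivity) (by push_cast; linarith) (by linarith)

lemma summable_succ_rpow_neg {s : ℝ} (hs : 1 < s) : Summable fun i : ℕ => ((i : ℝ) + 1) ^ (-s) := by
  have := (summable_nat_add_iff 1).2 (Real.summable_nat_rpow.2 (show -s < -1 by linarith))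
  simpa using this

lemma exists_abs_le_of_isBigO_rpow {x : ℕ → ℝ} {γ : ℝ} (hγ : 0 ≤ γ)
    (h : x =O[atTop] fun j : ℕ => (j : ℝ) ^ (-γ)) :
    ∃ C : ℝ, 0 < C ∧ ∀ j : ℕ, |x j| ≤ C * ((j : ℝ) + 1) ^ (-γ) := by
  have h2 : (fun j : ℕ => (j : ℝ) ^ (-γ)) =O[atTop] fun j : ℕ => ((j : ℝ) + 1) ^ (-γ) := by
    refine IsBigO.of_bound ((1 / 2 : ℝ) ^ (-γ)) ?_
    filter_upwards [eventually_ge_atTop 1] with j hj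
    have hj' : (1 : ℝ) ≤ j := by exact_mod_cast hj
    rw [Real.norm_of_nonneg (by positivity), Real.norm_of_nonneg (by positivity),
      ← Real.mul_rpow (by positivity) (by positivity)]
    exact Real.rpow_le_rpow_of_nonpos (by positivity) (by linarith) (by linarith)
  obtain ⟨C, hC, hb⟩ := bound_of_isBigO_nat_atTop (h.trans h2)
  refine ⟨C, hC, fun j => ?_⟩
  have hpos : (0 : ℝ) < ((j : ℝ) + 1) ^ (-γ) := by positivity
  have := hb (x := j) hpos.ne'
  rwa [Real.norm_of_nonneg hpos.le, Real.norm_eq_abs] at this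

lemma exists_abs_le_of_isBigO_pow {x : ℕ → ℝ} {ρ : ℝ} (hρ : 0 < ρ)
    (h : x =O[atTop] fun j : ℕ => ρ ^ j) : ∃ C : ℝ, 0 < C ∧ ∀ j : ℕ, |x j| ≤ C * ρ ^ j := by
  obtain ⟨C, hC, hb⟩ := bound_of_isBigO_nat_atTop h
  refine ⟨C, hC, fun j => ?_⟩
  have hpos : 0 < ρ ^ j := by positivity
  have := hb (x := j) hpos.ne'
  rwa [Real.norm_of_nonneg hpos.le, Real.norm_eq_abs] at this

/-- The series bound decays like `k^{4 - γν/(ν+1)}` if `a_j` and `ψ_j` decay like `j^{-γ}`. The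
envelope is `v_j = (j+1)^{-(γ-1-ε)}` with `ε = 1/(ν+1)`; the loss of `ε` in summing the tails and
again in summing over `i` is affordable because `k^{2ν/(ν+1)}` is short of `k²` by `k^{2ε}`. -/
lemma archMixingBound_polynomial {a : ℕ → ℝ} (ha0 : 0 < a 0) (ha : ∀ j, 0 ≤ a j) {ν : ℝ}
    (hν : 1 < ν) (M : ℝ) (L : ℝ≥0) {γ : ℝ} (hγ : 4 < γ * (ν / (ν + 1)))
    (hO : a =O[atTop] fun j : ℕ => (j : ℝ) ^ (-γ))
    (hOψ : archPsi a =O[atTop] fun j : ℕ => (j : ℝ) ^ (-γ)) :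
    ∃ K : ℝ, ∀ k : ℕ, 1 ≤ k → archMixingBound a ν M L k ≤ ENNReal.ofReal
      (K * (k * ((k : ℝ) + 1) ^ (-(γ * (ν / (ν + 1))) + 3)
        + ((k : ℝ) + 1) ^ (-(γ * (ν / (ν + 1))) + 2))) := by
  have hθ1 : ν / (ν + 1) < 1 := by rw [div_lt_one (by linarith)]; linarith
  have hθ2 : 1 / 2 < ν / (ν + 1) := by rw [div_lt_div_iff₀ (by norm_num) (by linarith)]; linarith
  obtain ⟨θ, hθ⟩ : ∃ θ, θ = ν / (ν + 1) := ⟨_, rfl⟩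
  rw [← hθ] at hγ hθ1 hθ2 ⊢
  have hγ4 : 4 < γ := by nlinarith
  obtain ⟨ε, hε⟩ : ∃ ε, ε = 1 - θ := ⟨_, rfl⟩
  obtain ⟨p, hp⟩ : ∃ p, p = γ - (1 + ε) := ⟨_, rfl⟩
  have hε0 : 0 < ε := by linarith
  have hp0 : 0 ≤ p := by linarith
  have hpθ : 0 ≤ p * θ - (1 + ε) := by rw [hp]; nlinarith
  obtain ⟨C₁, hC₁, h₁⟩ := exists_abs_le_of_isBigO_rpow (by linarith) hO
  obtain ⟨C₂, hC₂, h₂⟩ := exists_abs_le_of_isBigO_rpow (by linarith) hOψ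
  have hsum := summable_succ_rpow_neg (show 1 < 1 + ε by linarith)
  have hu0 : ∀ i : ℕ, (0 : ℝ) ≤ ((i : ℝ) + 1) ^ (-(1 + ε)) := fun i => by positivity
  set S := ∑' i : ℕ, ((i : ℝ) + 1) ^ (-(1 + ε)) with hS
  have hS0 : 0 ≤ S := tsum_nonneg hu0
  have hvle : ∀ j : ℕ, ((j : ℝ) + 1) ^ (-γ) ≤ ((j : ℝ) + 1) ^ (-p) := fun j =>
    Real.rpow_le_rpow_of_exponent_le (by linarith [Nat.cast_nonneg (α := ℝ) j]) (by linarith)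
  set C := C₁ + C₂ + C₁ * S with hC
  have hC0 : 0 ≤ C := by positivity
  have hav : ∀ j, a j ≤ C * ((j : ℝ) + 1) ^ (-p) := fun j => by
    refine ((le_abs_self _).trans (h₁ j)).trans ?_
    exact mul_le_mul (by nlinarith) (hvle j) (by positivity) hC0
  have hψv : ∀ j, |archPsi a j| ≤ C * ((j : ℝ) + 1) ^ (-p) := fun j => by
    refine (h₂ j).trans ?_
    exact mul_le_mul (by nlinarith) (hvle j) (by positivity) hC0
  have htail : ∀ q, archTail a q ≤ ENNReal.ofReal (C * ((q : ℝ) + 1) ^ (-p)) := fun q => by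
    calc archTail a q ≤ ∑' s : ℕ, ENNReal.ofReal
          (C₁ * ((q : ℝ) + 1) ^ (-p) * ((s : ℝ) + 1) ^ (-(1 + ε))) := by
          refine ENNReal.tsum_le_tsum fun s => ENNReal.ofReal_le_ofReal ?_
          refine ((le_abs_self _).trans (h₁ _)).trans ?_
          rw [mul_assoc]
          gcongr
          refine le_trans ?_ (rpow_neg_add_le hp0 (show 0 ≤ 1 + ε by linarith) q s)
          rw [show p + (1 + ε) = γ by rw [hp]; ring]
          refine Real.rpow_le_rpow_of_nonpos (by positivity) ?_ (by linarith)
          push_cast; linarith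
      _ = ENNReal.ofReal (C₁ * ((q : ℝ) + 1) ^ (-p) * S) := by
          rw [← ENNReal.ofReal_tsum_of_nonneg (fun s => by positivity) (hsum.mul_left _),
            tsum_mul_left]
      _ ≤ _ := by
          refine ENNReal.ofReal_le_ofReal ?_
          rw [mul_right_comm]
          gcongr
          linarith
  obtain ⟨E, hE0, hE⟩ := archMixingBound_le ha0 ha (v := fun j : ℕ => ((j : ℝ) + 1) ^ (-p))
    (fun j => by positivity) (fun x y => by
      rw [← Real.mul_rpow (by positivity) (by positivity)]
      refine Real.rpow_le_rpow_of_nonpos (by positivity) ?_ (by linarith)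
      push_cast
      nlinarith [mul_nonneg (Nat.cast_nonneg (α := ℝ) x) (Nat.cast_nonneg (α := ℝ) y)])
    hC0 hav hψv htail hν M L hsum hu0
    (b := fun m : ℕ => ((m : ℝ) + 1) ^ (-(p * θ - (1 + ε)))) (fun m => by positivity)
    (fun m i => by
      rw [← hθ, ← Real.rpow_mul (by positivity)]
      refine le_trans (le_of_eq ?_) (rpow_neg_add_le hpθ (show 0 ≤ 1 + ε by linarith) m i)
      congr 1; ring)
  refine ⟨E * (1 / 2 : ℝ) ^ (-(γ * θ) + 3), fun k hk => ?_⟩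
  obtain ⟨m, rfl⟩ : ∃ m, k = m + 1 := ⟨k - 1, by omega⟩
  refine (hE m).trans (ENNReal.ofReal_le_ofReal ?_)
  have hm : (0 : ℝ) ≤ m := Nat.cast_nonneg m
  rw [← hθ, ← Real.rpow_add (by positivity), mul_assoc]
  push_cast
  refine mul_le_mul_of_nonneg_left ?_ hE0
  calc ((m : ℝ) + 1) ^ (2 * θ + -(p * θ - (1 + ε)))
      ≤ ((m : ℝ) + 1) ^ (1 + (-(γ * θ) + 3)) :=
        Real.rpow_le_rpow_of_exponent_le (by linarith) (by rw [hp, hε]; nlinarith)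
    _ = ((m : ℝ) + 1) * ((m : ℝ) + 1) ^ (-(γ * θ) + 3) := by
        rw [Real.rpow_add (by positivity), Real.rpow_one]
    _ ≤ ((m : ℝ) + 1) * (1 / 2 * ((m : ℝ) + 1 + 1)) ^ (-(γ * θ) + 3) := by
        refine mul_le_mul_of_nonneg_left ?_ (by positivity)
        exact Real.rpow_le_rpow_of_nonpos (by positivity) (by linarith) (by linarith)
    _ = (1 / 2) ^ (-(γ * θ) + 3) * (((m : ℝ) + 1) * ((m : ℝ) + 1 + 1) ^ (-(γ * θ) + 3)) := by
        rw [Real.mul_rpow (by positivity) (by positivity)]; ring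
    _ ≤ _ := by
        gcongr
        exact le_add_of_nonneg_right (by positivity)

lemma exists_mul_pow_le {r : ℝ} (hr0 : 0 < r) (hr : r < 1) :
    ∃ B : ℝ, 0 ≤ B ∧ ∀ m : ℕ, ((m : ℝ) + 1) * r ^ m ≤ B := by
  have h := (tendsto_self_mul_const_pow_of_lt_one hr0.le hr).bddAbove_range
  obtain ⟨B, hB⟩ := h
  have hB' : ∀ m : ℕ, (m : ℝ) * r ^ m ≤ B := fun m => hB ⟨m, rfl⟩
  refine ⟨B / r, div_nonneg (by simpa using hB' 0) hr0.le, fun m => ?_⟩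
  rw [le_div_iff₀ hr0]
  have := hB' (m + 1)
  push_cast at this
  rw [pow_succ] at this
  linarith

/-- The geometric rate: `k^{2ν/(ν+1)} ρ^{kν/(ν+1)}` is `O(k ρ^{k/2})` since `ν/(ν+1) > 1/2`. -/
lemma archMixingBound_geometric {a : ℕ → ℝ} (ha0 : 0 < a 0) (ha : ∀ j, 0 ≤ a j) {ν : ℝ}
    (hν : 1 < ν) (M : ℝ) (L : ℝ≥0) {ρ : ℝ} (hρ0 : 0 < ρ) (hρ1 : ρ < 1)
    (hO : a =O[atTop] fun j : ℕ => ρ ^ j) (hOψ : archPsi a =O[atTop] fun j : ℕ => ρ ^ j) :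
    ∃ C : ℝ, ∀ k : ℕ, 1 ≤ k →
      archMixingBound a ν M L k ≤ ENNReal.ofReal (C * k * ρ ^ ((k : ℝ) / 2)) := by
  have hθ1 : ν / (ν + 1) < 1 := by rw [div_lt_one (by linarith)]; linarith
  have hθ2 : 1 / 2 < ν / (ν + 1) := by rw [div_lt_div_iff₀ (by norm_num) (by linarith)]; linarith
  obtain ⟨θ, hθ⟩ : ∃ θ, θ = ν / (ν + 1) := ⟨_, rfl⟩
  rw [← hθ] at hθ1 hθ2
  obtain ⟨C₁, hC₁, h₁⟩ := exists_abs_le_of_isBigO_pow hρ0 hO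
  obtain ⟨C₂, hC₂, h₂⟩ := exists_abs_le_of_isBigO_pow hρ0 hOψ
  have hsum := summable_geometric_of_lt_one hρ0.le hρ1
  set S := ∑' i : ℕ, ρ ^ i with hS
  have hS0 : 0 ≤ S := tsum_nonneg fun i => by positivity
  set C := C₁ + C₂ + C₁ * S with hC
  have hC0 : 0 ≤ C := by positivity
  have hav : ∀ j, a j ≤ C * ρ ^ j := fun j => by
    refine ((le_abs_self _).trans (h₁ j)).trans ?_
    gcongr
    nlinarith
  have hψv : ∀ j, |archPsi a j| ≤ C * ρ ^ j := fun j => by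
    refine (h₂ j).trans ?_
    gcongr
    nlinarith
  have htail : ∀ q, archTail a q ≤ ENNReal.ofReal (C * ρ ^ q) := fun q => by
    calc archTail a q ≤ ∑' s : ℕ, ENNReal.ofReal (C₁ * ρ ^ q * ρ ^ s) := by
          refine ENNReal.tsum_le_tsum fun s => ENNReal.ofReal_le_ofReal ?_
          refine ((le_abs_self _).trans (h₁ _)).trans ?_
          rw [mul_assoc, ← pow_add]
          refine mul_le_mul_of_nonneg_left ?_ hC₁.le
          exact pow_le_pow_of_le_one hρ0.le hρ1.le (show q + s ≤ q + 1 + s by omega)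
      _ = ENNReal.ofReal (C₁ * ρ ^ q * S) := by
          rw [← ENNReal.ofReal_tsum_of_nonneg (fun s => by positivity) (hsum.mul_left _),
            tsum_mul_left]
      _ ≤ _ := by
          refine ENNReal.ofReal_le_ofReal ?_
          rw [mul_right_comm]
          gcongr
          linarith
  have hr0 : 0 < ρ ^ θ := by positivity
  have hr1 : ρ ^ θ < 1 := Real.rpow_lt_one hρ0.le hρ1 (by linarith)
  obtain ⟨E, hE0, hE⟩ := archMixingBound_le ha0 ha (v := fun j : ℕ => ρ ^ j)
    (fun j => by positivity) (fun x y => (pow_add ρ x y).ge)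
    hC0 hav hψv htail hν M L (summable_geometric_of_lt_one hr0.le hr1) (fun i => by positivity)
    (b := fun m : ℕ => (ρ ^ θ) ^ m) (fun m => by positivity)
    (fun m i => by
      rw [← hθ, ← pow_add, Real.rpow_pow_comm hρ0.le])
  -- the surplus `ρ^{(θ-1/2)m}` absorbs the second factor of `(m+1)²`
  obtain ⟨B, hB0, hB⟩ := exists_mul_pow_le (r := ρ ^ (θ - 1 / 2)) (by positivity)
    (Real.rpow_lt_one hρ0.le hρ1 (by linarith))
  refine ⟨E * (B * ρ ^ (-(1 / 2) : ℝ)), fun k hk => ?_⟩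
  obtain ⟨m, rfl⟩ : ∃ m, k = m + 1 := ⟨k - 1, by omega⟩
  refine (hE m).trans (ENNReal.ofReal_le_ofReal ?_)
  have hm : (0 : ℝ) ≤ m := Nat.cast_nonneg m
  rw [← hθ, mul_assoc, mul_assoc]
  push_cast
  refine mul_le_mul_of_nonneg_left ?_ hE0
  calc ((m : ℝ) + 1) ^ (2 * θ) * (ρ ^ θ) ^ m
      ≤ ((m : ℝ) + 1) ^ (2 : ℝ) * (ρ ^ θ) ^ m := by
        gcongr
        · linarith
        · linarith
    _ = ((m : ℝ) + 1) * ρ ^ ((m : ℝ) / 2) * (((m : ℝ) + 1) * (ρ ^ (θ - 1 / 2)) ^ m) := by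
        have h1 : (ρ ^ θ) ^ m = ρ ^ ((m : ℝ) / 2) * (ρ ^ (θ - 1 / 2)) ^ m := by
          rw [← Real.rpow_mul_natCast hρ0.le, ← Real.rpow_mul_natCast hρ0.le,
            ← Real.rpow_add hρ0]
          congr 1; ring
        rw [h1, Real.rpow_two]; ring
    _ ≤ ((m : ℝ) + 1) * ρ ^ ((m : ℝ) / 2) * B := by gcongr; exact hB m
    _ = B * ρ ^ (-(1 / 2) : ℝ) * (((m : ℝ) + 1) * ρ ^ (((m : ℝ) + 1) / 2)) := by
        rw [show ((m : ℝ) + 1) / 2 = (m : ℝ) / 2 + 1 / 2 by ring, Real.rpow_add hρ0,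
          Real.rpow_neg hρ0.le]
        field_simp

/-- For mixing coefficients bounded by `2` the series bound implies both rates; if
`γν/(ν+1) ≤ 4` the polynomial rate is weaker than boundedness. -/
lemma archMixingRates_of_le {a : ℕ → ℝ} (ha0 : 0 < a 0) (ha : ∀ j, 0 ≤ a j) {ν : ℝ}
    (hν : 1 < ν) (M : ℝ) (L : ℝ≥0) {c : ℕ → ℝ≥0∞} (hc2 : ∀ k, c k ≤ 2)
    (hc : ∀ k : ℕ, 1 ≤ k → c k ≤ archMixingBound a ν M L k) : ArchMixingRates a ν M L c := by
  refine ⟨hc, fun γ hO hOψ => ?_, fun ρ hρ0 hρ1 hO hOψ => ?_⟩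
  · rcases lt_or_ge 4 (γ * (ν / (ν + 1))) with hγ | hγ
    · obtain ⟨K, hK⟩ := archMixingBound_polynomial ha0 ha hν M L hγ hO hOψ
      exact ⟨K, fun k hk => (hc k hk).trans (hK k hk)⟩
    · refine ⟨4, fun k hk => (hc2 k).trans ?_⟩
      rw [show (2 : ℝ≥0∞) = ENNReal.ofReal 2 by simp]
      refine ENNReal.ofReal_le_ofReal ?_
      have hk' : (1 : ℝ) ≤ k := by exact_mod_cast hk
      have h1 : ((k : ℝ) + 1) ^ (-1 : ℝ) ≤ ((k : ℝ) + 1) ^ (-(γ * (ν / (ν + 1))) + 3) :=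
        Real.rpow_le_rpow_of_exponent_le (by linarith) (by linarith)
      have h2 : (1 / 2 : ℝ) ≤ k * ((k : ℝ) + 1) ^ (-1 : ℝ) := by
        rw [Real.rpow_neg_one, ← div_eq_mul_inv, div_le_div_iff₀ (by norm_num) (by positivity)]
        linarith
      have h3 : (0 : ℝ) ≤ ((k : ℝ) + 1) ^ (-(γ * (ν / (ν + 1))) + 2) := by positivity
      nlinarith [mul_le_mul_of_nonneg_left h1 (by linarith : (0 : ℝ) ≤ k)]
  · obtain ⟨C, hC⟩ := archMixingBound_geometric ha0 ha hν M L hρ0 hρ1 hO hOψ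
    exact ⟨C, fun k hk => (hc k hk).trans (hC k hk)⟩

/-! ### The σ-algebras of the past and of the future -/

/-- The history `(X_t, X_{t-1}, …)` at time `t`. -/
def hist {Ω : Type*} (X : ℤ → Ω → ℝ) (t : ℤ) (ω : Ω) : ℕ → ℝ := fun j => X (t - j) ω

section Sigma

variable {Ω : Type*} (X : ℤ → Ω → ℝ)

lemma pastSigma_le_comap (t : ℤ) :
    pastSigma X t ≤ MeasurableSpace.comap (hist X t) inferInstance := by
  refine iSup₂_le fun s hs => ?_
  have : X s = (fun h : ℕ → ℝ => h (t - s).toNat) ∘ hist X t := by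
    funext ω
    simp only [hist, Function.comp_apply]
    rw [Int.toNat_of_nonneg (by omega), sub_sub_cancel]
  rw [this, ← MeasurableSpace.comap_comp]
  exact MeasurableSpace.comap_mono (measurable_pi_apply _).comap_le

lemma measurable_hist_pastSigma (t : ℤ) : Measurable[pastSigma X t] (hist X t) := by
  refine @measurable_pi_lambda _ _ _ (pastSigma X t) _ _ fun j => ?_
  refine Measurable.mono (ma := MeasurableSpace.comap (X (t - j)) inferInstance)
    (comap_measurable _) ?_ le_rfl
  exact le_iSup₂_of_le (t - j) (by omega) le_rfl

lemma pastSigma_mono {s t : ℤ} (h : s ≤ t) : pastSigma X s ≤ pastSigma X t :=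
  iSup₂_le fun u hu => le_iSup₂_of_le u (hu.trans h) le_rfl

lemma pastSigma_le [m : MeasurableSpace Ω] (hX : ∀ t, Measurable (X t)) (t : ℤ) :
    pastSigma X t ≤ m :=
  iSup₂_le fun s _ => (hX s).comap_le

lemma futureSigma_le [m : MeasurableSpace Ω] (hX : ∀ t, Measurable (X t)) (t : ℤ) :
    futureSigma X t ≤ m :=
  iSup₂_le fun s _ => (hX s).comap_le

lemma measurable_hist [MeasurableSpace Ω] (hX : ∀ t, Measurable (X t)) (t : ℤ) :
    Measurable (hist X t) :=
  measurable_pi_lambda _ fun _ => hX _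

/-- The filtration `r ↦ σ(X_u, …, X_{u+r})`. -/
def windowFiltration [m : MeasurableSpace Ω] (hX : ∀ t, Measurable (X t)) (u : ℤ) :
    Filtration ℕ m where
  seq r := ⨆ s : ℤ, ⨆ _ : u ≤ s ∧ s ≤ u + r, MeasurableSpace.comap (X s) inferInstance
  mono' r r' h := iSup₂_le fun s hs =>
    le_iSup₂_of_le s ⟨hs.1, hs.2.trans (by have : (r : ℤ) ≤ r' := by exact_mod_cast h
                                           omega)⟩ le_rfl
  le' r := iSup₂_le fun s _ => (hX s).comap_le

lemma futureSigma_le_iSup_windowFiltration [MeasurableSpace Ω] (hX : ∀ t, Measurable (X t))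
    (u : ℤ) : futureSigma X u ≤ ⨆ r, windowFiltration X hX u r := by
  refine iSup₂_le fun s hs => ?_
  refine le_iSup_of_le (s - u).toNat (le_iSup₂_of_le s ⟨hs, ?_⟩ le_rfl)
  omega

/-- The history `h` with all but its `N` newest values replaced by `0`. -/
def truncHist (N : ℕ) (h : ℕ → ℝ) : ℕ → ℝ := fun i => if i < N then h i else 0

lemma measurable_truncHist (N : ℕ) : Measurable (truncHist N) := by
  refine measurable_pi_lambda _ fun i => ?_
  by_cases hi : i < N
  · simpa [truncHist, hi] using measurable_pi_apply i
  · simp [truncHist, hi]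

lemma windowFiltration_le_comap [MeasurableSpace Ω] (hX : ∀ t, Measurable (X t)) (u : ℤ) (r : ℕ) :
    windowFiltration X hX u r
      ≤ MeasurableSpace.comap (truncHist (r + 1) ∘ hist X (u + r)) inferInstance := by
  refine iSup₂_le fun s hs => ?_
  have : X s = (fun h : ℕ → ℝ => h (u + r - s).toNat) ∘ (truncHist (r + 1) ∘ hist X (u + r)) := by
    funext ω
    have h1 : (u + r - s).toNat < r + 1 := by omega
    simp only [hist, Function.comp_apply, truncHist, h1, if_true]
    rw [Int.toNat_of_nonneg (by omega), sub_sub_cancel]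
  rw [this, ← MeasurableSpace.comap_comp]
  exact MeasurableSpace.comap_mono (measurable_pi_apply _).comap_le

/-- A function of `X_u, …, X_{u+r}` with values in `[-1, 1]` almost surely is almost surely a test
function of the `r + 1` newest values of the history at time `u + r`. -/
lemma exists_isTest_of_measurable_window [MeasurableSpace Ω] (hX : ∀ t, Measurable (X t))
    {P : Measure Ω} (u : ℤ) (r : ℕ) {g : Ω → ℝ} (hg : Measurable[windowFiltration X hX u r] g)
    (hg1 : ∀ᵐ ω ∂P, |g ω| ≤ 1) :
    ∃ ψ, IsTest ψ ∧ (∀ h h' : ℕ → ℝ, (∀ i < r + 1, h i = h' i) → ψ h = ψ h') ∧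
      g =ᵐ[P] fun ω => ψ (hist X (u + r) ω) := by
  obtain ⟨φ, hφ, hφg⟩ :=
    (hg.mono (windowFiltration_le_comap X hX u r) le_rfl).exists_eq_measurable_comp
  refine ⟨fun h => max (-1) (min 1 (φ (truncHist (r + 1) h))), ⟨?_, fun h => ?_⟩, ?_, ?_⟩
  · exact measurable_const.max (measurable_const.min (hφ.comp (measurable_truncHist _)))
  · rw [abs_le]
    exact ⟨le_max_left _ _, max_le (by norm_num) (min_le_left _ _)⟩
  · intro h h' hh
    have : truncHist (r + 1) h = truncHist (r + 1) h' := by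
      funext i
      by_cases hi : i < r + 1
      · simp [truncHist, hi, hh i hi]
      · simp [truncHist, hi]
    simp only [this]
  · filter_upwards [hg1] with ω hω
    have : g ω = φ (truncHist (r + 1) (hist X (u + r) ω)) := by rw [hφg]; rfl
    rw [← this, min_eq_right (abs_le.1 hω).2, max_eq_right (abs_le.1 hω).1]

end Sigma

/-! ### Covariances of the past with the future -/

section Covariance

variable {Ω : Type*} [MeasurableSpace Ω] {P : Measure Ω} {X Z : ℤ → Ω → ℝ} {a : ℕ → ℝ}

lemma IsSqARCHInfty.hist_succ (hX : IsSqARCHInfty P X Z a) (t : ℤ) :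
    ∀ᵐ ω ∂P, hist X (t + 1) ω
      = consHist (Z (t + 1) ω * archScale a (hist X t ω)) (hist X t ω) := by
  filter_upwards [hX.X_eq (t + 1), hX.X_summable (t + 1), ae_all_iff.2 hX.X_nonneg]
    with ω hω hs h0
  have hidx : ∀ j : ℕ, t + 1 - ((j : ℤ) + 1) = t - j := fun j => by ring
  simp only [hidx] at hω hs
  funext j
  cases j with
  | zero =>
    have : archScale a (hist X t ω) = a 0 + ∑' j : ℕ, a (j + 1) * X (t - j) ω := by
      unfold archScale hist
      have hn : ∀ j : ℕ, 0 ≤ a (j + 1) * X (t - j) ω := fun j =>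
        mul_nonneg (hX.param_nonneg _) (h0 _)
      rw [← ENNReal.ofReal_tsum_of_nonneg hn hs, ENNReal.toReal_ofReal (tsum_nonneg hn)]
    rw [consHist_zero, this, ← hω]
    simp [hist]
  | succ j =>
    simp only [hist, consHist_succ]
    congr 1
    push_cast
    ring

lemma IsSqARCHInfty.lintegral_enorm_innovation (hX : IsSqARCHInfty P X Z a) :
    ∫⁻ z, ‖z‖ₑ ∂(P.map (Z 0)) = 1 := by
  rw [lintegral_map measurable_enorm (hX.measurable_Z 0)]
  have hi : Integrable (Z 0) P := by
    by_contra h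
    have := hX.Z_mean
    rw [integral_undef h] at this
    exact zero_ne_one this
  rw [← ofReal_integral_norm_eq_lintegral_enorm hi, ← ENNReal.ofReal_one, ← hX.Z_mean]
  congr 1
  refine integral_congr_ae ?_
  filter_upwards [hX.Z_pos 0] with ω hω
  exact Real.norm_of_nonneg hω.le

variable [IsProbabilityMeasure P]

/-- Markov property of the histories, in integrated form. -/
lemma IsSqARCHInfty.setIntegral_hist_succ (hX : IsSqARCHInfty P X Z a) {ψ : (ℕ → ℝ) → ℝ}
    (hψ : IsTest ψ) (t : ℤ) {H : Set Ω} (hH : MeasurableSet[pastSigma X t] H) :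
    ∫ ω in H, ψ (hist X (t + 1) ω) ∂P
      = ∫ ω in H, archTransfer a (P.map (Z 0)) ψ (hist X t ω) ∂P := by
  obtain ⟨B, hB, rfl⟩ := pastSigma_le_comap X t H hH
  have hm := measurable_hist X hX.measurable_X t
  have hZ := hX.measurable_Z (t + 1)
  have hZ0 : P.map (Z (t + 1)) = P.map (Z 0) := (hX.Z_identDistrib (t + 1)).map_eq
  have : IsProbabilityMeasure (P.map (Z 0)) :=
    Measure.isProbabilityMeasure_map (hX.measurable_Z 0).aemeasurable
  have : IsProbabilityMeasure (P.map (hist X t)) :=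
    Measure.isProbabilityMeasure_map hm.aemeasurable
  have hind : IndepFun (hist X t) (Z (t + 1)) P := by
    have h := hX.Z_indep_past (t + 1)
    rw [add_sub_cancel_right] at h
    exact (indep_of_indep_of_le_right h (measurable_hist_pastSigma X t).comap_le).symm
  -- the event is part of the integrand, so that both sides become integrals of a function of the
  -- independent pair `(h_t, Z_{t+1})`
  set F : (ℕ → ℝ) × ℝ → ℝ := fun p =>
    B.indicator (fun h => ψ (consHist (p.2 * archScale a h) h)) p.1 with hF
  have hFeq : F = (Prod.fst ⁻¹' B).indicator
      (fun p : (ℕ → ℝ) × ℝ => ψ (consHist (p.2 * archScale a p.1) p.1)) := by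
    funext p
    by_cases hp : p.1 ∈ B <;> simp [hF, hp]
  have hFm : Measurable F := by
    rw [hFeq]
    exact (hψ.measurable.comp (measurable_nextHist a)).indicator (measurable_fst hB)
  have hFi : Integrable F ((P.map (hist X t)).prod (P.map (Z 0))) := by
    rw [hFeq]
    exact (hψ.integrable_comp (measurable_nextHist a)).indicator (measurable_fst hB)
  calc ∫ ω in hist X t ⁻¹' B, ψ (hist X (t + 1) ω) ∂P
      = ∫ ω, F (hist X t ω, Z (t + 1) ω) ∂P := by
        rw [← integral_indicator (hm hB)]
        refine integral_congr_ae ?_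
        filter_upwards [hX.hist_succ t] with ω hω
        by_cases hp : hist X t ω ∈ B <;> simp [hF, hp, hω]
    _ = ∫ p, F p ∂((P.map (hist X t)).prod (P.map (Z 0))) := by
        rw [← hZ0, ← (indepFun_iff_map_prod_eq_prod_map_map hm.aemeasurable hZ.aemeasurable).1 hind,
          integral_map (hm.prodMk hZ).aemeasurable hFm.aestronglyMeasurable]
    _ = ∫ h, B.indicator (archTransfer a (P.map (Z 0)) ψ) h ∂(P.map (hist X t)) := by
        rw [integral_prod _ hFi]
        refine integral_congr_ae (ae_of_all _ fun h => ?_)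
        by_cases hp : h ∈ B <;> simp [hF, hp, archTransfer]
    _ = ∫ ω in hist X t ⁻¹' B, archTransfer a (P.map (Z 0)) ψ (hist X t ω) ∂P := by
        rw [integral_map hm.aemeasurable
          (hψ.archTransfer.measurable.indicator hB).aestronglyMeasurable,
          ← integral_indicator (hm hB)]
        rfl

lemma IsSqARCHInfty.setIntegral_hist_add (hX : IsSqARCHInfty P X Z a) {ψ : (ℕ → ℝ) → ℝ}
    (hψ : IsTest ψ) (t : ℤ) (n : ℕ) {H : Set Ω} (hH : MeasurableSet[pastSigma X t] H) :
    ∫ ω in H, ψ (hist X (t + n) ω) ∂P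
      = ∫ ω in H, (archTransfer a (P.map (Z 0)))^[n] ψ (hist X t ω) ∂P := by
  have : IsProbabilityMeasure (P.map (Z 0)) :=
    Measure.isProbabilityMeasure_map (hX.measurable_Z 0).aemeasurable
  induction n generalizing ψ with
  | zero => simp
  | succ n ih =>
    have h := hX.setIntegral_hist_succ hψ (t + n) (pastSigma_mono X (by omega) H hH)
    rw [Function.iterate_succ_apply, ← ih hψ.archTransfer, ← h]
    push_cast
    rw [add_assoc]

/-- The average of `min(2, ∑_j w_j |x_j - x'_j|)` over the history `x` at time `t` and an
independent copy `x'` of it, with `x` restricted to the event `H`. -/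
noncomputable def copyDist (P : Measure Ω) (X : ℤ → Ω → ℝ) (t : ℤ) (w : ℕ → ℝ≥0∞) (H : Set Ω) :
    ℝ≥0∞ :=
  ∫⁻ ω in H, ∫⁻ ω', min 2 (histDist w (hist X t ω) (hist X t ω')) ∂P ∂P

/-- If conditionally on the past a quantity is the function `φ` of the history, the covariance with
an event of the past compares `φ` at two independent histories. -/
lemma edist_setIntegral_le_copyDist (hX : ∀ t, Measurable (X t)) (t : ℤ) {φ : (ℕ → ℝ) → ℝ}
    (hφ : IsTest φ) {w : ℕ → ℝ≥0∞} (hw : ∀ h h', edist (φ h) (φ h') ≤ histDist w h h')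
    (H : Set Ω) :
    edist (∫ ω in H, φ (hist X t ω) ∂P) (P.real H * ∫ ω, φ (hist X t ω) ∂P)
      ≤ copyDist P X t w H := by
  have hi : ∀ Q : Measure Ω, ∀ [IsFiniteMeasure Q], Integrable (fun ω => φ (hist X t ω)) Q :=
    fun Q _ => hφ.integrable_comp (measurable_hist X hX t)
  have h2 : P.real H * ∫ ω, φ (hist X t ω) ∂P = ∫ _ω in H, (∫ ω', φ (hist X t ω') ∂P) ∂P := by
    simp
  rw [h2]
  refine (edist_integral_le (hi _) (integrable_const _)).trans (lintegral_mono fun ω => ?_)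
  have h3 : φ (hist X t ω) = ∫ _ω' : Ω, φ (hist X t ω) ∂P := by simp
  simp only
  rw [h3]
  refine (edist_integral_le (integrable_const _) (hi _)).trans (lintegral_mono fun ω' => ?_)
  refine le_min ?_ (hw _ _)
  rw [edist_dist, Real.dist_eq, show (2 : ℝ≥0∞) = ENNReal.ofReal 2 by simp]
  refine ENNReal.ofReal_le_ofReal ((abs_sub _ _).trans ?_)
  linarith [hφ.abs_le (hist X t ω), hφ.abs_le (hist X t ω')]

/-- Covariance bound between an event of the past and a function of a finite stretch
`X_{t+m+1}, …, X_{t+m+1+r}` of the future: the `r + 1` innovations of the stretch are replaced one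
at a time, the `m` innovations before it are common to both histories. -/
lemma IsSqARCHInfty.edist_window_le (hX : IsSqARCHInfty P X Z a) {f : ℝ → ℝ} {L : ℝ≥0}
    (hf : IsDensityOf P (Z 0) f) (hL : DilationLipschitz f L) (t : ℤ) (m r : ℕ)
    {ψ : (ℕ → ℝ) → ℝ} (hψ : IsTest ψ)
    (hdep : ∀ h h' : ℕ → ℝ, (∀ i < r + 1, h i = h' i) → ψ h = ψ h')
    {H : Set Ω} (hH : MeasurableSet[pastSigma X t] H) :
    edist (∫ ω in H, ψ (hist X (t + (m + 1 : ℕ) + r) ω) ∂P)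
        (P.real H * ∫ ω, ψ (hist X (t + (m + 1 : ℕ) + r) ω) ∂P)
      ≤ copyDist P X t (fun i => (1 + L) * archBracket a (m + 1) i) H := by
  have : IsProbabilityMeasure (P.map (Z 0)) :=
    Measure.isProbabilityMeasure_map (hX.measurable_Z 0).aemeasurable
  have htime : t + (m + 1 : ℕ) + r = t + (m + (r + 1) : ℕ) := by push_cast; ring
  have huniv : ∫ ω, ψ (hist X (t + (m + (r + 1) : ℕ)) ω) ∂P
      = ∫ ω, (archTransfer a (P.map (Z 0)))^[m + (r + 1)] ψ (hist X t ω) ∂P := by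
    have := hX.setIntegral_hist_add hψ t (m + (r + 1)) (H := Set.univ)
      (@MeasurableSet.univ _ (pastSigma X t))
    simpa using this
  rw [htime, hX.setIntegral_hist_add hψ t _ hH, huniv]
  refine edist_setIntegral_le_copyDist hX.measurable_X t (hψ.archTransfer_iterate _)
    (fun h h' => ?_) H
  rw [Function.iterate_add_apply]
  refine (edist_archTransfer_iterate_le_weightStep hX.param_nonneg hX.lintegral_enorm_innovation
    (hψ.archTransfer_iterate (r + 1))
    (w := fun j => (1 + L) * ENNReal.ofReal (1 / a 0) * archTail a j) (fun u u' => ?_) m h h').trans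
    ?_
  · refine (edist_archTransfer_iterate_le hX.param_pos hX.param_nonneg hf.measurable hf.nonneg
      hf.map_eq hL hψ (r + 1) 0 hdep u u' (by simp)).trans ?_
    unfold histDist archTail
    simp_rw [← ENNReal.tsum_mul_left]
    rw [← Summable.tsum_finsetSum fun _ _ => ENNReal.summable]
    refine ENNReal.tsum_le_tsum fun j => ?_
    rw [← ENNReal.tsum_mul_right]
    refine le_trans (le_of_eq ?_) (ENNReal.sum_le_tsum (Finset.range (r + 1)))
    exact Finset.sum_congr rfl fun s _ => by ring
  · unfold histDist
    gcongr with i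
    exact weightStep_iterate_le_archBracket hX.param_nonneg L m i

/-- The covariance bound for functions of the whole future, by Lévy's upward theorem. -/
lemma IsSqARCHInfty.edist_future_le (hX : IsSqARCHInfty P X Z a) {f : ℝ → ℝ} {L : ℝ≥0}
    (hf : IsDensityOf P (Z 0) f) (hL : DilationLipschitz f L) (t : ℤ) (m : ℕ) {g : Ω → ℝ}
    (hg : Measurable[futureSigma X (t + (m + 1 : ℕ))] g) (hg1 : ∀ ω, |g ω| ≤ 1)
    {H : Set Ω} (hH : MeasurableSet[pastSigma X t] H) :
    edist (∫ ω in H, g ω ∂P) (P.real H * ∫ ω, g ω ∂P)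
      ≤ copyDist P X t (fun i => (1 + L) * archBracket a (m + 1) i) H := by
  set ℱ := windowFiltration X hX.measurable_X (t + (m + 1 : ℕ)) with hℱ
  have hgi : Integrable g P := Integrable.of_bound
    (hg.mono (futureSigma_le X hX.measurable_X _) le_rfl).aestronglyMeasurable 1
    (ae_of_all _ hg1)
  have hlim := hgi.tendsto_eLpNorm_condExp (ℱ := ℱ)
    (hg.mono (futureSigma_le_iSup_windowFiltration X hX.measurable_X _) le_rfl).stronglyMeasurable
  have hI : ∀ᶠ r in atTop, Integrable (P[g | ℱ r]) P := Eventually.of_forall fun r =>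
    integrable_condExp
  have h1 := tendsto_setIntegral_of_L1' g hgi.aestronglyMeasurable hI hlim H
  have h2 := tendsto_integral_of_L1' g hgi.aestronglyMeasurable hI hlim
  refine le_of_tendsto (h1.edist (tendsto_const_nhds.mul h2)) (Eventually.of_forall fun r => ?_)
  have hb : ∀ᵐ ω ∂P, |(P[g | ℱ r]) ω| ≤ 1 := by
    filter_upwards [ae_bdd_abs_condExp_of_ae_bdd_abs (m := ℱ r) (ae_of_all P hg1)] with ω hω
    exact hω
  obtain ⟨ψ, hψ, hdep, hae⟩ := exists_isTest_of_measurable_window X hX.measurable_X (P := P)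
    (t + (m + 1 : ℕ)) r (stronglyMeasurable_condExp (m := ℱ r) (f := g) (μ := P)).measurable hb
  rw [integral_congr_ae hae, setIntegral_congr_ae₀ (g := fun ω => ψ (hist X _ ω))
    ((pastSigma_le X hX.measurable_X t) H hH).nullMeasurableSet (hae.mono fun ω h _ => h)]
  exact hX.edist_window_le hf hL t m r hψ hdep hH

end Covariance

/-! ### Finite partitions -/

lemma isFinPartition_compl {Ω : Type*} {m : MeasurableSpace Ω} {A : Set Ω}
    (hA : MeasurableSet[m] A) :
    IsFinPartition m ![A, Aᶜ] where
  measurable i := by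
    fin_cases i
    · exact hA
    · exact hA.compl
  disjoint i j hij := by
    fin_cases i <;> fin_cases j
    · exact absurd rfl hij
    · exact disjoint_compl_right
    · exact disjoint_compl_left
    · exact absurd rfl hij
  cover := by
    ext ω
    simp [Fin.exists_fin_two, em]

lemma IsFinPartition.abs_sum_indicator_le {Ω : Type*} {m : MeasurableSpace Ω} {n : ℕ}
    {G : Fin n → Set Ω} (hG : IsFinPartition m G) {ε : Fin n → ℝ} (hε : ∀ i, |ε i| ≤ 1) (ω : Ω) :
    |∑ i, (G i).indicator (fun _ => ε i) ω| ≤ 1 := by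
  obtain ⟨i, hi⟩ := Set.mem_iUnion.1 (hG.cover ▸ Set.mem_univ ω)
  rw [Finset.sum_eq_single i (fun j _ hj => Set.indicator_of_notMem
    (fun hω => Set.disjoint_left.1 (hG.disjoint hj) hω hi) _) (by simp),
    Set.indicator_of_mem hi]
  exact hε i

/-- The sum of the absolute covariances of an event with the blocks of a partition is the covariance
with the sum of the signed indicators of the blocks. -/
lemma IsFinPartition.exists_sum_abs_eq {Ω : Type*} {m₀ : MeasurableSpace Ω} [m : MeasurableSpace Ω]
    {P : Measure Ω} [IsProbabilityMeasure P] (hm : m₀ ≤ m) {n : ℕ}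
    {G : Fin n → Set Ω} (hG : IsFinPartition m₀ G) (H : Set Ω) :
    ∃ g : Ω → ℝ, Measurable[m₀] g ∧ (∀ ω, |g ω| ≤ 1) ∧
      ∑ i, |P.real (G i ∩ H) - P.real (G i) * P.real H|
        = ∫ ω in H, g ω ∂P - P.real H * ∫ ω, g ω ∂P := by
  set d : Fin n → ℝ := fun i => P.real (G i ∩ H) - P.real (G i) * P.real H with hd
  -- `ε i` is the sign of the `i`-th covariance
  set ε : Fin n → ℝ := fun i => if 0 ≤ d i then 1 else -1 with hε
  have hεd : ∀ i, |d i| = ε i * d i := fun i => by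
    by_cases h : 0 ≤ d i
    · simp [hε, h, abs_of_nonneg h]
    · simp [hε, h, abs_of_neg (not_le.1 h)]
  have hε1 : ∀ i, |ε i| ≤ 1 := fun i => by
    by_cases h : 0 ≤ d i <;> simp [hε, h]
  have hGm : ∀ i, MeasurableSet (G i) := fun i => hm _ (hG.measurable i)
  refine ⟨fun ω => ∑ i, (G i).indicator (fun _ => ε i) ω, ?_,
    fun ω => hG.abs_sum_indicator_le hε1 ω, ?_⟩
  · exact Finset.measurable_sum _ fun i _ =>
      (@measurable_const _ _ _ m₀ _).indicator (hG.measurable i)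
  · have hi : ∀ Q : Measure Ω, ∀ [IsFiniteMeasure Q], ∀ i ∈ (Finset.univ : Finset (Fin n)),
        Integrable (fun ω => (G i).indicator (fun _ => ε i) ω) Q := fun Q _ i _ =>
      (integrable_const _).indicator (hGm i)
    simp only
    rw [integral_finsetSum _ (hi _), integral_finsetSum _ (hi _), Finset.mul_sum,
      ← Finset.sum_sub_distrib]
    refine Finset.sum_congr rfl fun i _ => ?_
    change |d i| = _
    rw [hεd, integral_indicator_const _ (hGm i), integral_indicator_const _ (hGm i),
      measureReal_restrict_apply (hGm i), smul_eq_mul, smul_eq_mul, hd]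
    ring

/-! ### Mixing coefficients -/

section Mixing

variable {Ω : Type*} [MeasurableSpace Ω] {P : Measure Ω} [IsProbabilityMeasure P]
  {X Z : ℤ → Ω → ℝ} {a : ℕ → ℝ}

lemma IsSqARCHInfty.sum_le_copyDist (hX : IsSqARCHInfty P X Z a) {f : ℝ → ℝ} {L : ℝ≥0}
    (hf : IsDensityOf P (Z 0) f) (hL : DilationLipschitz f L) (t : ℤ) (m : ℕ) {p n : ℕ}
    {H : Fin p → Set Ω} (hH : IsFinPartition (pastSigma X t) H) {G : Fin n → Set Ω}
    (hG : IsFinPartition (futureSigma X (t + (m + 1 : ℕ))) G) :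
    ENNReal.ofReal (∑ i, ∑ j, |P.real (G i ∩ H j) - P.real (G i) * P.real (H j)|)
      ≤ copyDist P X t (fun i => (1 + L) * archBracket a (m + 1) i) Set.univ := by
  have hHm : ∀ j, MeasurableSet (H j) := fun j =>
    pastSigma_le X hX.measurable_X t _ (hH.measurable j)
  rw [Finset.sum_comm, ENNReal.ofReal_sum_of_nonneg fun j _ =>
    Finset.sum_nonneg fun i _ => abs_nonneg _]
  calc _ ≤ ∑ j, copyDist P X t (fun i => (1 + L) * archBracket a (m + 1) i) (H j) := by
        refine Finset.sum_le_sum fun j _ => ?_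
        obtain ⟨g, hg, hg1, heq⟩ := hG.exists_sum_abs_eq (P := P)
          (futureSigma_le X hX.measurable_X _) (H j)
        rw [heq]
        refine le_trans ?_ (hX.edist_future_le hf hL t m hg hg1 (hH.measurable j))
        rw [edist_dist, Real.dist_eq]
        exact ENNReal.ofReal_le_ofReal (le_abs_self _)
    _ = _ := by
        unfold copyDist
        rw [← hH.cover, lintegral_iUnion hHm hH.disjoint, tsum_fintype]

lemma rpow_tsum_le_tsum_rpow {θ : ℝ} (hθ0 : 0 < θ) (hθ1 : θ ≤ 1) (x : ℕ → ℝ≥0∞) :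
    (∑' j, x j) ^ θ ≤ ∑' j, x j ^ θ := by
  have hfin : ∀ s : Finset ℕ, (∑ j ∈ s, x j) ^ θ ≤ ∑ j ∈ s, x j ^ θ := fun s => by
    induction s using Finset.induction_on with
    | empty => simp [hθ0]
    | insert j s hj ih =>
      rw [Finset.sum_insert hj, Finset.sum_insert hj]
      exact (ENNReal.rpow_add_le_add_rpow _ _ hθ0.le hθ1).trans (by gcongr)
  have ht := (ENNReal.continuous_rpow_const (y := θ)).continuousAt.tendsto.comp
    (ENNReal.summable (f := x)).hasSum
  exact le_of_tendsto ht (Eventually.of_forall fun s => (hfin s).trans (ENNReal.sum_le_tsum s))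

lemma min_two_le_rpow {θ : ℝ} (hθ0 : 0 < θ) (hθ1 : θ < 1) (x : ℝ≥0∞) :
    min 2 x ≤ 2 ^ (1 - θ) * x ^ θ := by
  have hy : min 2 x ≠ ∞ := ne_top_of_le_ne_top (by simp) (min_le_left _ _)
  rcases eq_or_ne (min 2 x) 0 with h0 | h0
  · rw [h0]; exact zero_le
  calc min 2 x = (min 2 x) ^ (1 - θ) * (min 2 x) ^ θ := by
        rw [← ENNReal.rpow_add _ _ h0 hy]; simp
    _ ≤ _ := by
        have : 0 ≤ 1 - θ := by linarith
        gcongr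
        · exact min_le_left _ _
        · exact min_le_right _ _

lemma lintegral_rpow_enorm_le (hX : ∀ t, Measurable (X t)) (hstat : IsStrictlyStationary P X)
    {θ ν : ℝ} (hθ : 0 < θ) (hθν : θ ≤ ν) (hmom : Integrable (fun ω => |X 0 ω| ^ ν) P) (s : ℤ) :
    ∫⁻ ω, ‖X s ω‖ₑ ^ θ ∂P ≤ ENNReal.ofReal ((∫ ω, |X 0 ω| ^ ν ∂P) ^ (θ / ν)) := by
  have hν : 0 < ν := hθ.trans_le hθν
  have h1 : ∫⁻ ω, ‖X s ω‖ₑ ^ ν ∂P = ∫⁻ ω, ‖X 0 ω‖ₑ ^ ν ∂P := by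
    have h := congrArg (fun Q : Measure (ℤ → ℝ) => ∫⁻ x, ‖x 0‖ₑ ^ ν ∂Q) (hstat s)
    have hm : Measurable fun x : ℤ → ℝ => ‖x 0‖ₑ ^ ν :=
      (measurable_pi_apply (0 : ℤ)).enorm.pow_const ν
    beta_reduce at h
    rw [lintegral_map hm (measurable_pi_lambda _ fun t => hX _),
      lintegral_map hm (measurable_pi_lambda _ fun t => hX _)] at h
    simpa using h
  have h2 : ∫⁻ ω, ‖X 0 ω‖ₑ ^ ν ∂P = ENNReal.ofReal (∫ ω, |X 0 ω| ^ ν ∂P) := by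
    rw [ofReal_integral_eq_lintegral_ofReal hmom (ae_of_all _ fun ω => by positivity)]
    refine lintegral_congr fun ω => ?_
    rw [← ENNReal.ofReal_rpow_of_nonneg (abs_nonneg _) hν.le, Real.enorm_eq_ofReal_abs]
  have h3 := eLpNorm'_le_eLpNorm'_of_exponent_le hθ hθν P (hX s).aestronglyMeasurable
  rw [eLpNorm'_eq_lintegral_enorm, eLpNorm'_eq_lintegral_enorm, h1, h2] at h3
  have h4 := ENNReal.rpow_le_rpow h3 hθ.le
  rw [← ENNReal.rpow_mul, ← ENNReal.rpow_mul, one_div_mul_cancel hθ.ne', ENNReal.rpow_one,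
    ENNReal.ofReal_rpow_of_nonneg (by positivity) (by positivity)] at h4
  rwa [one_div_mul_eq_div] at h4

/-- Interpolation: `min(2, y) ≤ 2^{1-θ} y^θ` with `θ = ν/(ν+1)`, subadditivity of `y ↦ y^θ`, and
Jensen's inequality for the exponents `θ ≤ ν`. The constant is `2^{2-θ} ≤ 3 ≤ K(ν)`. -/
lemma copyDist_univ_le (hX : ∀ t, Measurable (X t)) (hstat : IsStrictlyStationary P X) {ν : ℝ}
    (hν : 1 < ν) (hmom : Integrable (fun ω => |X 0 ω| ^ ν) P) (t : ℤ) (w : ℕ → ℝ≥0∞) :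
    copyDist P X t w Set.univ ≤ ENNReal.ofReal (archK ν) *
      ∑' i, w i ^ (ν / (ν + 1)) * ENNReal.ofReal ((∫ ω, |X 0 ω| ^ ν ∂P) ^ (1 / (ν + 1))) := by
  have hθ1 : ν / (ν + 1) < 1 := by rw [div_lt_one (by linarith)]; linarith
  have hθ2 : 1 / 2 < ν / (ν + 1) := by rw [div_lt_div_iff₀ (by norm_num) (by linarith)]; linarith
  have hθν : ν / (ν + 1) / ν = 1 / (ν + 1) := by field_simp
  set θ := ν / (ν + 1) with hθ
  have hθ0 : 0 < θ := by linarith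
  set N := ENNReal.ofReal ((∫ ω, |X 0 ω| ^ ν ∂P) ^ (1 / (ν + 1))) with hN
  have hmo : ∀ s, ∫⁻ ω, ‖X s ω‖ₑ ^ θ ∂P ≤ N := fun s => by
    rw [hN, ← hθν]
    exact lintegral_rpow_enorm_le hX hstat hθ0 (by linarith) hmom s
  have hXm : ∀ s, Measurable fun ω => ‖X s ω‖ₑ ^ θ := fun s => (hX s).enorm.pow_const θ
  have hconst : (2 : ℝ≥0∞) ^ (1 - θ) * 2 ≤ ENNReal.ofReal (archK ν) := by
    have h1 : (2 : ℝ) ^ (1 - θ) ≤ 3 / 2 := by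
      calc (2 : ℝ) ^ (1 - θ) ≤ 2 ^ (1 / 2 : ℝ) :=
            Real.rpow_le_rpow_of_exponent_le (by norm_num) (by linarith)
        _ = √2 := (Real.sqrt_eq_rpow 2).symm
        _ ≤ 3 / 2 := Real.sqrt_le_iff.2 (by norm_num)
    have h2 : 3 ≤ archK ν := by
      unfold archK
      have h3 : 1 ≤ ν ^ (1 / (1 + ν)) := Real.one_le_rpow hν.le (by positivity)
      have h4 : 0 ≤ ν ^ (-(ν / (ν + 1))) := by positivity
      linarith
    have h5 : (2 : ℝ≥0∞) ^ (1 - θ) * 2 = ENNReal.ofReal (2 ^ (1 - θ) * 2) := by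
      rw [ENNReal.ofReal_mul (by positivity), ← ENNReal.ofReal_rpow_of_pos (by norm_num)]
      simp
    rw [h5]
    exact ENNReal.ofReal_le_ofReal (by linarith)
  have hpt : ∀ x y : ℝ, edist x y ^ θ ≤ ‖x‖ₑ ^ θ + ‖y‖ₑ ^ θ := fun x y => by
    refine le_trans ?_ (ENNReal.rpow_add_le_add_rpow _ _ hθ0.le hθ1.le)
    gcongr
    rw [edist_eq_enorm_sub]
    exact enorm_sub_le
  unfold copyDist
  rw [Measure.restrict_univ]
  calc ∫⁻ ω, ∫⁻ ω', min 2 (histDist w (hist X t ω) (hist X t ω')) ∂P ∂P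
      ≤ ∫⁻ ω, ∫⁻ ω', 2 ^ (1 - θ) *
          ∑' i : ℕ, w i ^ θ * (‖X (t - i) ω‖ₑ ^ θ + ‖X (t - i) ω'‖ₑ ^ θ) ∂P ∂P := by
        refine lintegral_mono fun ω => lintegral_mono fun ω' => ?_
        refine (min_two_le_rpow hθ0 hθ1 _).trans ?_
        gcongr
        refine (rpow_tsum_le_tsum_rpow hθ0 hθ1.le _).trans ?_
        gcongr with i
        rw [ENNReal.mul_rpow_of_nonneg _ _ hθ0.le]
        gcongr
        exact hpt _ _
    _ = 2 ^ (1 - θ) * ∑' i : ℕ, w i ^ θ *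
          (∫⁻ ω, ‖X (t - i) ω‖ₑ ^ θ ∂P + ∫⁻ ω, ‖X (t - i) ω‖ₑ ^ θ ∂P) := by
        have hin : ∀ ω, ∫⁻ ω', 2 ^ (1 - θ) *
            ∑' i : ℕ, w i ^ θ * (‖X (t - i) ω‖ₑ ^ θ + ‖X (t - i) ω'‖ₑ ^ θ) ∂P
            = 2 ^ (1 - θ) * ∑' i : ℕ, w i ^ θ *
              (‖X (t - i) ω‖ₑ ^ θ + ∫⁻ ω', ‖X (t - i) ω'‖ₑ ^ θ ∂P) := fun ω => by
          have hm : ∀ i : ℕ, Measurable fun ω' =>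
              w i ^ θ * (‖X (t - i) ω‖ₑ ^ θ + ‖X (t - i) ω'‖ₑ ^ θ) := fun i =>
            ((hXm _).const_add _).const_mul _
          rw [lintegral_const_mul _ (Measurable.tsum hm),
            lintegral_tsum fun i => (hm i).aemeasurable]
          congr 1
          refine tsum_congr fun i => ?_
          rw [lintegral_const_mul _ ((hXm _).const_add _),
            lintegral_add_left measurable_const]
          simp
        simp_rw [hin]
        have hm : ∀ i : ℕ, Measurable fun ω =>
            w i ^ θ * (‖X (t - i) ω‖ₑ ^ θ + ∫⁻ ω', ‖X (t - i) ω'‖ₑ ^ θ ∂P) := fun i =>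
          ((hXm _).add_const _).const_mul _
        rw [lintegral_const_mul _ (Measurable.tsum hm),
          lintegral_tsum fun i => (hm i).aemeasurable]
        congr 1
        refine tsum_congr fun i => ?_
        rw [lintegral_const_mul _ ((hXm _).add_const _),
          lintegral_add_right _ measurable_const]
        simp
    _ ≤ 2 ^ (1 - θ) * ∑' i : ℕ, w i ^ θ * (N + N) := by
        gcongr with i
        · exact hmo _
        · exact hmo _
    _ = 2 ^ (1 - θ) * 2 * ∑' i : ℕ, w i ^ θ * N := by
        rw [mul_assoc, ← ENNReal.tsum_mul_left (a := 2)]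
        congr 1
        refine tsum_congr fun i => ?_
        ring
    _ ≤ _ := by gcongr

lemma IsSqARCHInfty.betaMixing_le (hX : IsSqARCHInfty P X Z a) (hstat : IsStrictlyStationary P X)
    {f : ℝ → ℝ} {L : ℝ≥0} (hf : IsDensityOf P (Z 0) f) (hL : DilationLipschitz f L) {ν : ℝ}
    (hν : 1 < ν) (hmom : Integrable (fun ω => |X 0 ω| ^ ν) P) {k : ℕ} (hk : 1 ≤ k) :
    betaMixing P X k ≤ archMixingBound a ν (∫ ω, |X 0 ω| ^ ν ∂P) L k := by
  obtain ⟨m, rfl⟩ : ∃ m, k = m + 1 := ⟨k - 1, by omega⟩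
  unfold betaMixing
  refine iSup_le fun t => iSup_le fun p => iSup_le fun H => iSup_le fun hH => iSup_le fun n =>
    iSup_le fun G => iSup_le fun hG => ?_
  refine (hX.sum_le_copyDist hf hL t m hH hG).trans
    ((copyDist_univ_le hX.measurable_X hstat hν hmom t _).trans (le_of_eq ?_))
  have hθ0 : 0 ≤ ν / (ν + 1) := by positivity
  unfold archMixingBound
  rw [ENNReal.ofReal_mul (archK_nonneg hν), mul_assoc,
    ← ENNReal.tsum_mul_left (a := ENNReal.ofReal ((1 + (L : ℝ)) ^ (ν / (ν + 1))))]
  refine congrArg _ (tsum_congr fun i => ?_)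
  rw [ENNReal.mul_rpow_of_nonneg _ _ hθ0, mul_assoc,
    ← ENNReal.ofReal_rpow_of_pos (by positivity : (0 : ℝ) < 1 + L),
    ENNReal.ofReal_add zero_le_one L.coe_nonneg, ENNReal.ofReal_one, ENNReal.ofReal_coe_nnreal]

lemma alphaMixing_le_betaMixing (P : Measure Ω) (X : ℤ → Ω → ℝ) (k : ℕ) :
    alphaMixing P X k ≤ betaMixing P X k := by
  unfold alphaMixing
  refine iSup_le fun t => iSup_le fun H => iSup_le fun hH => iSup_le fun G => iSup_le fun hG => ?_
  unfold betaMixing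
  refine le_iSup_of_le t (le_iSup_of_le 2 (le_iSup_of_le ![H, Hᶜ] (le_iSup_of_le
    (isFinPartition_compl hH) (le_iSup_of_le 2 (le_iSup_of_le ![G, Gᶜ] (le_iSup_of_le
      (isFinPartition_compl hG) ?_))))))
  refine ENNReal.ofReal_le_ofReal ?_
  simp only [Fin.sum_univ_two, Matrix.cons_val_zero, Matrix.cons_val_one]
  have h1 := abs_nonneg (P.real (G ∩ Hᶜ) - P.real G * P.real Hᶜ)
  have h2 := abs_nonneg (P.real (Gᶜ ∩ H) - P.real Gᶜ * P.real H)
  have h3 := abs_nonneg (P.real (Gᶜ ∩ Hᶜ) - P.real Gᶜ * P.real Hᶜ)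
  linarith

lemma betaMixing_le_two (hX : ∀ t, Measurable (X t)) (k : ℕ) : betaMixing P X k ≤ 2 := by
  unfold betaMixing
  refine iSup_le fun t => iSup_le fun p => iSup_le fun H => iSup_le fun hH => iSup_le fun n =>
    iSup_le fun G => iSup_le fun hG => ?_
  rw [show (2 : ℝ≥0∞) = ENNReal.ofReal 2 by simp]
  refine ENNReal.ofReal_le_ofReal ?_
  have hHm : ∀ j, MeasurableSet (H j) := fun j => pastSigma_le X hX t _ (hH.measurable j)
  rw [Finset.sum_comm]
  calc ∑ j, ∑ i, |P.real (G i ∩ H j) - P.real (G i) * P.real (H j)|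
      ≤ ∑ j, 2 * P.real (H j) := by
        refine Finset.sum_le_sum fun j _ => ?_
        obtain ⟨g, -, hg1, heq⟩ := hG.exists_sum_abs_eq (P := P) (futureSigma_le X hX _) (H j)
        rw [heq]
        have e1 := norm_setIntegral_le_of_norm_le_const (μ := P) (s := H j) (C := 1) (f := g)
          (measure_lt_top _ _) fun ω _ => hg1 ω
        have e2 := norm_integral_le_of_norm_le_const (μ := P) (C := 1) (f := g)
          (ae_of_all _ hg1)
        rw [Real.norm_eq_abs] at e1 e2
        simp only [probReal_univ, mul_one, one_mul] at e1 e2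
        have e3 : 0 ≤ P.real (H j) := measureReal_nonneg
        nlinarith [(abs_le.1 e1).2, (abs_le.1 e2).1]
    _ = 2 * P.real (⋃ j, H j) := by
        rw [← Finset.mul_sum, measureReal_iUnion_fintype hH.disjoint hHm]
    _ = 2 := by rw [hH.cover]; simp

end Mixing

lemma SupDilationLipschitz.dilationLipschitz {f : ℝ → ℝ} {L : ℝ≥0}
    (h : SupDilationLipschitz f L) : DilationLipschitz f L := fun c hc =>
  (lintegral_mono fun u => le_iSup₂_of_le
    (f := fun τ (_ : τ ∈ Set.Icc (0 : ℝ) c) => ENNReal.ofReal |f u - f (u * (1 + τ))|) c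
    ⟨hc.le, le_rfl⟩ le_rfl).trans (h c hc)

theorem theorem4p1 {Ω : Type*} [MeasurableSpace Ω] (P : Measure Ω) [IsProbabilityMeasure P]
    (X Z : ℤ → Ω → ℝ) (a : ℕ → ℝ) (f : ℝ → ℝ) (L : ℝ≥0) (δ ν : ℝ)
    (hX : IsSqARCHInfty P X Z a) (hstat : IsStrictlyStationary P X)
    (hf : IsDensityOf P (Z 0) f)
    (hδ : 0 < δ) (hsum : Summable fun j : ℕ => a (j + 1)) (ha : ∑' j : ℕ, a (j + 1) < 1 - δ)
    (hν : 1 < ν) (hmom : Integrable (fun ω => |X 0 ω| ^ ν) P) :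
    (DilationLipschitz f L →
      ArchMixingRates a ν (∫ ω, |X 0 ω| ^ ν ∂P) L (alphaMixing P X)) ∧
    (SupDilationLipschitz f L →
      ArchMixingRates a ν (∫ ω, |X 0 ω| ^ ν ∂P) L (betaMixing P X)) := by
  have key : DilationLipschitz f L →
      ArchMixingRates a ν (∫ ω, |X 0 ω| ^ ν ∂P) L (betaMixing P X) ∧
      ArchMixingRates a ν (∫ ω, |X 0 ω| ^ ν ∂P) L (alphaMixing P X) := fun hL => by
    have hβ := fun (k : ℕ) (hk : 1 ≤ k) => hX.betaMixing_le hstat hf hL hν hmom hk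
    have hβ2 := fun k : ℕ => betaMixing_le_two (P := P) hX.measurable_X k
    have hαβ := alphaMixing_le_betaMixing P X
    exact ⟨archMixingRates_of_le hX.param_pos hX.param_nonneg hν _ L hβ2 hβ,
      archMixingRates_of_le hX.param_pos hX.param_nonneg hν _ L
        (fun k => (hαβ k).trans (hβ2 k)) fun k hk => (hαβ k).trans (hβ k hk)⟩
  exact ⟨fun hL => (key hL).2, fun hL => (key hL.dilationLipschitz).1⟩
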